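/- Let $(\Omega,\mathcal P)$ be a probability space and $0<A<B<1$. Let $(a_n,b_n)_{n\ge1}$ be i.i.d. random pairs with $A\le\min(a_n,b_n)$ and $a_n+b_n\le B$. Let $(p_n)_{n\ge1}$ be i.i.d. random variables in $[0,1]$, independent of $(a_n,b_n)_{n\ge 1}$, with $\mathbb E(p_1^{-t})<\infty$ and $\mathbb E((1-p_1)^{-t})<\infty$ for some $t>0$ (where $0^{-t}=\infty$). For each $\omega$, start from the interval $[0,1]$ of level $0$; an interval $I$ of level $n-1$ has two children of level $n$: the subinterval of length $a_n|I|$ sharing its left endpoint and the subinterval of length $b_n|I|$ sharing its right endpoint. Let $\mu_\omega$ be the Borel probability measure with $\mu_\omega([0,1])=1$ that gives the left and right child of each interval $I$ of level $n-1$ the masses $p_n\,\mu_\omega(I)$ and $(1-p_n)\,\mu_\omega(I)$, respectively. For $\theta\ge0$ put $(Y,Z)=(\log p_1,\log a_1)$ if $p_1\le \frac{a_1^\theta}{a_1^\theta+b_1^\theta}$ and $(Y,Z)=(\log(1-p_1),\log b_1)$ otherwise, and put $(Y',Z')=(\log p_1,\log a_1)$ if $p_1> \frac{a_1^\theta}{a_1^\theta+b_1^\theta}$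 and $(Y',Z')=(\log(1-p_1),\log b_1)$ otherwise. Set $G(\theta)=\mathbb E(Y)/\mathbb E(Z)$ and $G'(\theta)=\mathbb E(Y')/\mathbb E(Z')$. A dimension function is a map $\Phi:(0,1)\to[0,\infty)$ such that $t^{1+\Phi(t)}$ decreases to $0$ as $t$ decreases to $0$. It is large if $\Phi(t)=H(t)\,\frac{\log|\log t|}{|\log t|}$ for all $t$ near $0$, where $H(t)\to\infty$ as $t\to0$. For a finite Borel measure $\mu$ on $\mathbb R$, $\overline{\dim}_\Phi\mu$ is the infimum of all $d\in\mathbb R$ for which there are $C_1,C_2>0$ such that $$\frac{\mu(B(x,R))}{\mu(B(x,r))}\le C_2\Big(\frac Rr\Big)^d\quad\text{for all } x\in\operatorname{supp}\mu \text{ and all } 0<r<R^{1+\Phi(R)},\ 0<R<1,\ R\le C_1,$$ and $\underline{\dim}_\Phi\mu$ is the supremum of all $d$ for which this holds with $\ge$ in place of $\le$. The upper and lower local dimensions $\overline{\dim}_{\mathrm{loc}}\mu(x)$, $\underline{\dim}_{\mathrm{loc}}\mu(x)$ at $x\in\operatorname{supp}\mu$ are the $\limsup$ and $\liminf$ of $\frac{\log\mu(B(x,r))}{\log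 r}$ as $r\to0^+$. Here $B(x,r)$ is the open ball. **Proposition.** (i) Let $\theta\ge0$ satisfy $G(\theta)=\theta$ and $G(\psi)<\psi$ for all $\psi>\theta$. Then for almost every $\omega$, $$\sup_{x\in\operatorname{supp}\mu_\omega}\overline{\dim}_{\mathrm{loc}}\mu_\omega(x)=\theta=\overline{\dim}_\Phi\mu_\omega\quad\text{for every large dimension function }\Phi.$$ (ii) Let $\theta'\ge0$ satisfy $G'(\theta')=\theta'$ and $G'(\psi)>\psi$ for all $0\le\psi<\theta'$. Then for almost every $\omega$, $$\inf_{x\in\operatorname{supp}\mu_\omega}\underline{\dim}_{\mathrm{loc}}\mu_\omega(x)=\theta'=\underline{\dim}_\Phi\mu_\omega\quad\text{for every large dimension function }\Phi.$$ -/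

import Mathlib

open MeasureTheory ProbabilityTheory Filter Set
open scoped Topology ENNReal

noncomputable section

/-! ### Assouad-like dimensions and local dimensions of measures on the line -/

/-- A dimension function is a map `Φ : (0,1) → [0,∞)` such that `t ^ (1 + Φ t)` decreases to `0`
as `t` decreases to `0`. Only the values of `Φ` on `(0,1)` matter. -/
structure IsDimensionFunction (Φ : ℝ → ℝ) : Prop where
  nonneg : ∀ t ∈ Ioo (0 : ℝ) 1, 0 ≤ Φ t
  monotoneOn : MonotoneOn (fun t : ℝ => t ^ (1 + Φ t)) (Ioo 0 1)
  tendsto_zero : Tendsto (fun t : ℝ => t ^ (1 + Φ t)) (𝓝[>] 0) (𝓝 0)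

/-- A dimension function `Φ` is large if `Φ t = H t * log |log t| / |log t|` near `0`,
where `H t → ∞` as `t → 0`. -/
def IsLargeDimensionFunction (Φ : ℝ → ℝ) : Prop :=
  IsDimensionFunction Φ ∧ ∃ H : ℝ → ℝ, Tendsto H (𝓝[>] 0) atTop ∧
    ∀ᶠ t in 𝓝[>] (0 : ℝ), Φ t = H t * (Real.log |Real.log t| / |Real.log t|)

/-- The upper `Φ`-dimension of a measure, as an extended real number. -/
def upperPhiDim (Φ : ℝ → ℝ) (μ : Measure ℝ) : EReal :=
  sInf ((fun d : ℝ => (d : EReal)) '' {d : ℝ | ∃ C₁ > 0, ∃ C₂ > 0,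
    ∀ R r : ℝ, 0 < R → R < 1 → R ≤ C₁ → 0 < r → r < R ^ (1 + Φ R) → ∀ x ∈ μ.support,
      μ.real (Metric.ball x R) / μ.real (Metric.ball x r) ≤ C₂ * (R / r) ^ d})

/-- The lower `Φ`-dimension of a measure, as an extended real number. -/
def lowerPhiDim (Φ : ℝ → ℝ) (μ : Measure ℝ) : EReal :=
  sSup ((fun d : ℝ => (d : EReal)) '' {d : ℝ | ∃ C₁ > 0, ∃ C₂ > 0,
    ∀ R r : ℝ, 0 < R → R < 1 → R ≤ C₁ → 0 < r → r < R ^ (1 + Φ R) → ∀ x ∈ μ.support,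
      C₂ * (R / r) ^ d ≤ μ.real (Metric.ball x R) / μ.real (Metric.ball x r)})

/-- The upper local dimension of `μ` at a point `x` of its support. -/
def upperLocalDim (μ : Measure ℝ) (x : ℝ) : EReal :=
  limsup (fun r : ℝ => ((Real.log (μ.real (Metric.ball x r)) / Real.log r : ℝ) : EReal)) (𝓝[>] 0)

/-- The lower local dimension of `μ` at a point `x` of its support. -/
def lowerLocalDim (μ : Measure ℝ) (x : ℝ) : EReal :=
  liminf (fun r : ℝ => ((Real.log (μ.real (Metric.ball x r)) / Real.log r : ℝ) : EReal)) (𝓝[>] 0)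

/-! ### Moran intervals and Moran measures

The sequences are indexed from `0`: the step from level `n` to level `n + 1` uses
`a n`, `b n`, `p n`. A word is read off a sequence `v : ℕ → Bool`, where `false` stands for the
left child and `true` for the right child. -/

/-- The length of the Moran interval of level `n` along `v`. -/
def moranLength (a b : ℕ → ℝ) (v : ℕ → Bool) : ℕ → ℝ
  | 0 => 1
  | n + 1 => (if v n then b n else a n) * moranLength a b v n

/-- The left endpoint of the Moran interval of level `n` along `v`: the left child shares the left
endpoint of its parent, the right child shares the right endpoint of its parent. -/
def moranLeft (a b : ℕ → ℝ) (v : ℕ → Bool) : ℕ → ℝ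
  | 0 => 0
  | n + 1 => moranLeft a b v n + if v n then (1 - b n) * moranLength a b v n else 0

/-- The Moran interval of level `n` along `v`; it depends only on `v 0, …, v (n - 1)`. -/
def moranInterval (a b : ℕ → ℝ) (v : ℕ → Bool) (n : ℕ) : Set ℝ :=
  Icc (moranLeft a b v n) (moranLeft a b v n + moranLength a b v n)

/-- The point of the Moran set lying in all the Moran intervals along `v`. -/
def moranPoint (a b : ℕ → ℝ) (v : ℕ → Bool) : ℝ := ⨆ n, moranLeft a b v n

/-- The Moran measure: the law of the point `moranPoint a b v` when the digits `v n` are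
independent, the left child being chosen at step `n` with probability `p n` and the right child
with probability `1 - p n`. -/
def moranMeasure (a b : ℕ → ℝ) (p : ℕ → unitInterval) : Measure ℝ :=
  (Measure.infinitePi fun n => bernoulliMeasure false true (p n)).map (moranPoint a b)

section MoranFacts

variable {a b : ℕ → ℝ}

theorem moranLength_pos (ha : ∀ n, 0 < a n) (hb : ∀ n, 0 < b n) (v : ℕ → Bool) (n : ℕ) :
    0 < moranLength a b v n := by
  induction n with
  | zero => simp [moranLength]
  | succ n ih =>
    rw [moranLength]
    split_ifs
    · exact mul_pos (hb n) ih
    · exact mul_pos (ha n) ih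

theorem moranInterval_succ_subset (ha : ∀ n, 0 < a n) (hb : ∀ n, 0 < b n)
    (hab : ∀ n, a n + b n < 1) (v : ℕ → Bool) (n : ℕ) :
    moranInterval a b v (n + 1) ⊆ moranInterval a b v n := by
  have hl := moranLength_pos ha hb v n
  have h1 := ha n
  have h2 := hb n
  have h3 := hab n
  refine Icc_subset_Icc ?_ ?_ <;> simp only [moranLeft, moranLength] <;> split_ifs <;> nlinarith

theorem moranPoint_mem (ha : ∀ n, 0 < a n) (hb : ∀ n, 0 < b n)
    (hab : ∀ n, a n + b n < 1) (v : ℕ → Bool) (n : ℕ) :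
    moranPoint a b v ∈ moranInterval a b v n := by
  have h := antitone_nat_of_succ_le (f := moranInterval a b v)
    (fun n => moranInterval_succ_subset ha hb hab v n)
  have := ciSup_mem_iInter_Icc_of_antitone_Icc (f := moranLeft a b v)
    (g := fun n => moranLeft a b v n + moranLength a b v n) h
    (fun n => by linarith [moranLength_pos ha hb v n])
  exact mem_iInter.1 this n

theorem moranLeft_length_congr {v w : ℕ → Bool} {n : ℕ} (h : ∀ i < n, v i = w i) :
    moranLeft a b v n = moranLeft a b w n ∧ moranLength a b v n = moranLength a b w n := by
  induction n with
  | zero => simp [moranLeft, moranLength]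
  | succ n ih =>
    obtain ⟨h1, h2⟩ := ih fun i hi => h i (by omega)
    simp only [moranLeft, moranLength, h1, h2, h n (by omega), and_self]

theorem eq_of_mem_moranInterval (ha : ∀ n, 0 < a n) (hb : ∀ n, 0 < b n)
    (hab : ∀ n, a n + b n < 1) {v w : ℕ → Bool} {y : ℝ} {n : ℕ}
    (hv : y ∈ moranInterval a b v n) (hw : y ∈ moranInterval a b w n) :
    ∀ i < n, v i = w i := by
  induction n with
  | zero => intro i hi; omega
  | succ n ih =>
    have h := ih (moranInterval_succ_subset ha hb hab v n hv)
      (moranInterval_succ_subset ha hb hab w n hw)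
    intro i hi
    rcases Nat.lt_succ_iff_lt_or_eq.1 hi with hi | rfl
    · exact h i hi
    obtain ⟨h1, h2⟩ := moranLeft_length_congr (a := a) (b := b) h
    have hl := moranLength_pos ha hb w i
    have h3 := hab i
    simp only [moranInterval, moranLeft, moranLength, mem_Icc, h1, h2] at hv hw
    cases hvi : v i <;> cases hwi : w i <;> simp only [hvi, hwi] at hv hw ⊢ <;>
      simp at hv hw <;> nlinarith

theorem measurable_moranPoint (a b : ℕ → ℝ) : Measurable (moranPoint a b) := by
  have hlen : ∀ n, Measurable fun v => moranLength a b v n := by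
    intro n
    induction n with
    | zero => simp only [moranLength]; fun_prop
    | succ n ih =>
      simp only [moranLength]
      exact (Measurable.ite (measurableSet_eq_fun (measurable_pi_apply n) measurable_const)
        measurable_const measurable_const).mul ih
  have hleft : ∀ n, Measurable fun v => moranLeft a b v n := by
    intro n
    induction n with
    | zero => simp only [moranLeft]; fun_prop
    | succ n ih =>
      simp only [moranLeft]
      exact ih.add (Measurable.ite (measurableSet_eq_fun (measurable_pi_apply n) measurable_const)
        ((hlen n).const_mul _) measurable_const)
  exact Measurable.iSup hleft

/-- The rule that determines the Moran measure: the mass of a Moran interval is the product of the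
weights of its ancestors; in particular `[0,1]` has mass `1`, and the left and the right child of a
Moran interval of level `n` receive the fractions `p n` and `1 - p n` of its mass. -/
theorem moranMeasure_moranInterval (ha : ∀ n, 0 < a n) (hb : ∀ n, 0 < b n)
    (hab : ∀ n, a n + b n < 1) (p : ℕ → unitInterval) (v : ℕ → Bool) (n : ℕ) :
    moranMeasure a b p (moranInterval a b v n) =
      ∏ i ∈ Finset.range n, ENNReal.ofReal (if v i then 1 - (p i : ℝ) else p i) := by
  have hpre : moranPoint a b ⁻¹' moranInterval a b v n =
      (Finset.range n : Set ℕ).pi fun i => {v i} := by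
    ext w
    simp only [mem_preimage, Set.mem_pi, Finset.coe_range, mem_Iio, mem_singleton_iff]
    constructor
    · exact fun h => eq_of_mem_moranInterval ha hb hab (moranPoint_mem ha hb hab w n) h
    · intro h
      obtain ⟨h1, h2⟩ := moranLeft_length_congr (a := a) (b := b) h
      have := moranPoint_mem ha hb hab w n
      rwa [moranInterval, h1, h2] at this
  have hmeas : MeasurableSet (moranInterval a b v n) := measurableSet_Icc
  rw [moranMeasure, Measure.map_apply (measurable_moranPoint a b) hmeas, hpre,
    Measure.infinitePi_pi _ (fun i _ => measurableSet_singleton _)]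
  refine Finset.prod_congr rfl fun i _ => ?_
  rw [bernoulliMeasure_def]
  have h0 : unitInterval.toNNReal (p i) = (p i : ℝ).toNNReal :=
    NNReal.eq (Real.coe_toNNReal _ (p i).2.1).symm
  have h1 : unitInterval.toNNReal (unitInterval.symm (p i)) = (1 - (p i : ℝ)).toNNReal :=
    NNReal.eq (Real.coe_toNNReal _ (unitInterval.symm (p i)).2.1).symm
  cases v i <;> simp [ENNReal.ofReal, h0, h1]

end MoranFacts

/-! ### The random model -/

/-- The standing assumptions on the random data: the pairs `(a n, b n)` are i.i.d. with
`A ≤ min (a n) (b n)` and `a n + b n ≤ B`, where `0 < A < B < 1`; the weights `p n ∈ [0,1]` are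
i.i.d. and independent of the pairs; and `𝔼 (p n)⁻ᵗ < ∞`, `𝔼 (1 - p n)⁻ᵗ < ∞` for some `t > 0`
(expectations in `[0,∞]`, with `0⁻ᵗ = ∞`). -/
structure IsRandomMoranModel {Ω : Type*} [MeasurableSpace Ω] (P : Measure Ω) (A B : ℝ)
    (a b : ℕ → Ω → ℝ) (p : ℕ → Ω → unitInterval) : Prop where
  A_pos : 0 < A
  A_lt_B : A < B
  B_lt_one : B < 1
  A_le_min : ∀ n ω, A ≤ min (a n ω) (b n ω)
  add_le_B : ∀ n ω, a n ω + b n ω ≤ B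
  measurable_a : ∀ n, Measurable (a n)
  measurable_b : ∀ n, Measurable (b n)
  measurable_p : ∀ n, Measurable (p n)
  iIndepFun_ab : iIndepFun (fun n ω => (a n ω, b n ω)) P
  identDistrib_ab : ∀ n, IdentDistrib (fun ω => (a n ω, b n ω)) (fun ω => (a 0 ω, b 0 ω)) P P
  iIndepFun_p : iIndepFun p P
  identDistrib_p : ∀ n, IdentDistrib (p n) (p 0) P P
  indepFun_ab_p : IndepFun (fun ω n => (a n ω, b n ω)) (fun ω n => p n ω) P
  moment_p : ∃ t : ℝ, 0 < t ∧
    ∫⁻ ω, ENNReal.ofReal (p 0 ω : ℝ) ^ (-t) ∂P < ∞ ∧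
    ∫⁻ ω, ENNReal.ofReal (1 - (p 0 ω : ℝ)) ^ (-t) ∂P < ∞

/-- `G θ = 𝔼 Y / 𝔼 Z`, where `Y = log p`, `Z = log a` if `p ≤ a ^ θ / (a ^ θ + b ^ θ)`, and
`Y = log (1 - p)`, `Z = log b` otherwise, for a random triple `(a, b, p)`. -/
def moranG {Ω : Type*} [MeasurableSpace Ω] (P : Measure Ω) (a b : Ω → ℝ) (p : Ω → unitInterval)
    (θ : ℝ) : ℝ :=
  (∫ ω, (if (p ω : ℝ) ≤ a ω ^ θ / (a ω ^ θ + b ω ^ θ)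
      then Real.log (p ω) else Real.log (1 - (p ω : ℝ))) ∂P) /
    ∫ ω, (if (p ω : ℝ) ≤ a ω ^ θ / (a ω ^ θ + b ω ^ θ)
      then Real.log (a ω) else Real.log (b ω)) ∂P

/-- `G' θ = 𝔼 Y' / 𝔼 Z'`, defined like `G` with the relation between `p` and
`a ^ θ / (a ^ θ + b ^ θ)` interchanged: `Y' = log p`, `Z' = log a` if
`p > a ^ θ / (a ^ θ + b ^ θ)`, and `Y' = log (1 - p)`, `Z' = log b` otherwise. -/
def moranG' {Ω : Type*} [MeasurableSpace Ω] (P : Measure Ω) (a b : Ω → ℝ) (p : Ω → unitInterval)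
    (θ : ℝ) : ℝ :=
  (∫ ω, (if a ω ^ θ / (a ω ^ θ + b ω ^ θ) < (p ω : ℝ)
      then Real.log (p ω) else Real.log (1 - (p ω : ℝ))) ∂P) /
    ∫ ω, (if a ω ^ θ / (a ω ^ θ + b ω ^ θ) < (p ω : ℝ)
      then Real.log (a ω) else Real.log (b ω)) ∂P

/-- The random Moran measure `μ_ω`. -/
def randomMoranMeasure {Ω : Type*} (a b : ℕ → Ω → ℝ) (p : ℕ → Ω → unitInterval) (ω : Ω) :
    Measure ℝ :=
  moranMeasure (fun n => a n ω) (fun n => b n ω) (fun n => p n ω)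

end

/-!
For a child `c` of a Moran interval put `moranStep d c = d * log (ratio of c) - log (weight of c)`,
so that along a coding sequence the sum of the steps is `log (|I| ^ d / μ I)`. The equation
`G θ = θ` says precisely that the largest of the two steps for `d = θ` has mean zero.

For `d > θ` the largest step has negative mean, and its exponential moments are finite because of
the negative moments of the weights. By Chernoff's bound and the Borel–Cantelli lemma, almost surely
its sums over all level ranges `[N, N + k)` with `k ≥ K log (N + 1)` and `N` large are nonpositive.
A large dimension function only compares radii that are at least so many levels apart, hence
`μ B(x, R) / μ B(x, r) ≤ C (R / r) ^ d` for every `x` simultaneously. Along the path that chooses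
the larger step at each level, the strong law of large numbers gives local dimension `θ`.

The lower dimensions are governed in the same way by the smallest step; it is bounded because one
of the two weights is at least `1 / 2`.
-/

section Independence

variable {Ω ι α β : Type*} [MeasurableSpace Ω] {P : Measure Ω} [MeasurableSpace α]
  [MeasurableSpace β] {X : ι → Ω → α} {Y : ι → Ω → β}

theorem iIndepFun_prodMk_of_finite [Finite ι] (mX : ∀ i, AEMeasurable (X i) P)
    (mY : ∀ i, AEMeasurable (Y i) P) (hX : iIndepFun X P) (hY : iIndepFun Y P)
    (hXY : IndepFun (fun ω i => X i ω) (fun ω i => Y i ω) P) :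
    iIndepFun (fun i ω => (X i ω, Y i ω)) P := by
  cases nonempty_fintype ι
  have := hX.isProbabilityMeasure
  have (i : ι) : IsProbabilityMeasure (P.map (X i)) := Measure.isProbabilityMeasure_map (mX i)
  have (i : ι) : IsProbabilityMeasure (P.map (Y i)) := Measure.isProbabilityMeasure_map (mY i)
  have hXYi (i : ι) : P.map (fun ω => (X i ω, Y i ω)) = (P.map (X i)).prod (P.map (Y i)) :=
    (indepFun_iff_map_prod_eq_prod_map_map (mX i) (mY i)).1
      (hXY.comp (measurable_pi_apply i) (measurable_pi_apply i))
  let e := MeasurableEquiv.arrowProdEquivProdArrow α β ι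
  rw [iIndepFun_iff_map_fun_eq_pi_map fun i => (mX i).prodMk (mY i)]
  calc P.map (fun ω i => (X i ω, Y i ω))
      = (P.map fun ω => (fun i => X i ω, fun i => Y i ω)).map e.symm :=
        (AEMeasurable.map_map_of_aemeasurable e.symm.measurable.aemeasurable
          ((aemeasurable_pi_lambda _ mX).prodMk (aemeasurable_pi_lambda _ mY))).symm
    _ = ((Measure.pi fun i => P.map (X i)).prod (Measure.pi fun i => P.map (Y i))).map e.symm := by
        rw [(indepFun_iff_map_prod_eq_prod_map_map (by fun_prop) (by fun_prop)).1 hXY,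
          hX.map_fun_eq_pi_map mX, hY.map_fun_eq_pi_map mY]
    _ = Measure.pi fun i => P.map fun ω => (X i ω, Y i ω) := by
        simp only [hXYi]
        exact ((measurePreserving_arrowProdEquivProdArrow α β ι _ _).symm e).map_eq

theorem iIndepFun_prodMk (mX : ∀ i, AEMeasurable (X i) P) (mY : ∀ i, AEMeasurable (Y i) P)
    (hX : iIndepFun X P) (hY : iIndepFun Y P)
    (hXY : IndepFun (fun ω i => X i ω) (fun ω i => Y i ω) P) :
    iIndepFun (fun i ω => (X i ω, Y i ω)) P :=
  iIndepFun_iff_finset.2 fun s =>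
    iIndepFun_prodMk_of_finite (fun i => mX i) (fun i => mY i)
      (hX.precomp Subtype.val_injective) (hY.precomp Subtype.val_injective)
      (hXY.comp (Finset.measurable_restrict s) (Finset.measurable_restrict s))

end Independence

section NegativeDrift

/-- A relation `Q N M` between levels holds across logarithmic gaps if it holds for all large `N`
and all `M ≥ N + K log (N + 1)`, for some constant `K`. -/
def HoldsAcrossLogGaps (Q : ℕ → ℕ → Prop) : Prop :=
  ∃ K : ℝ, ∀ᶠ N : ℕ in atTop, ∀ k : ℕ, K * Real.log (N + 1) ≤ k → Q N (N + k)

theorem HoldsAcrossLogGaps.mono {Q Q' : ℕ → ℕ → Prop} (hQ : HoldsAcrossLogGaps Q)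
    (h : ∀ N k, Q N (N + k) → Q' N (N + k)) : HoldsAcrossLogGaps Q' :=
  hQ.imp fun _ hK => hK.mono fun N hN k hk => h N k (hN k hk)

theorem pow_le_one_div_add_one_sq {τ : ℝ} (hτ0 : 0 < τ) (hτ1 : τ < 1) {N k : ℕ}
    (hk : 2 / -Real.log τ * Real.log (N + 1) ≤ k) : τ ^ k ≤ 1 / ((N : ℝ) + 1) ^ 2 := by
  have hlog : 0 < -Real.log τ := neg_pos.2 (Real.log_neg hτ0 hτ1)
  rw [div_mul_eq_mul_div, div_le_iff₀ hlog] at hk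
  rw [← Real.log_le_log_iff (by positivity) (by positivity), one_div, Real.log_inv, Real.log_pow,
    Real.log_pow]
  push_cast
  linarith

variable {Ω : Type*} [MeasurableSpace Ω] {P : Measure Ω}

theorem ae_holdsAcrossLogGaps_of_measure_le {Q : Ω → ℕ → ℕ → Prop} {ρ : ℝ} (hρ0 : 0 < ρ)
    (hρ1 : ρ < 1) (hQ : ∀ N k, P {ω | ¬Q ω N (N + k)} ≤ ENNReal.ofReal (ρ ^ k)) :
    ∀ᵐ ω ∂P, HoldsAcrossLogGaps (Q ω) := by
  set τ := √ρ with hτ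
  have hτ0 : 0 < τ := Real.sqrt_pos.2 hρ0
  have hτ1 : τ < 1 := by rw [hτ, Real.sqrt_lt' one_pos]; simpa using hρ1
  set K := 2 / -Real.log τ
  let E (q : ℕ × ℕ) : Set Ω := {ω | K * Real.log (q.1 + 1) ≤ q.2 ∧ ¬Q ω q.1 (q.1 + q.2)}
  -- Half of the exponential decay in `k` makes the bound summable in `N`, the other half in `k`.
  have hE (q : ℕ × ℕ) : P (E q) ≤ ENNReal.ofReal (1 / ((q.1 : ℝ) + 1) ^ 2 * τ ^ q.2) := by
    by_cases hq : K * Real.log (q.1 + 1) ≤ q.2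
    · refine (measure_mono fun ω h => h.2).trans
        ((hQ q.1 q.2).trans (ENNReal.ofReal_le_ofReal ?_))
      rw [← Real.mul_self_sqrt hρ0.le, mul_pow]
      gcongr
      exact pow_le_one_div_add_one_sq hτ0 hτ1 hq
    · simp [E, hq]
  have hsum : Summable fun q : ℕ × ℕ => 1 / ((q.1 : ℝ) + 1) ^ 2 * τ ^ q.2 :=
    Summable.mul_of_nonneg (f := fun n : ℕ => 1 / ((n : ℝ) + 1) ^ 2)
      (by simpa using (summable_nat_add_iff 1).2 (Real.summable_one_div_nat_pow.2 one_lt_two))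
      (summable_geometric_of_lt_one hτ0.le hτ1) (fun n => by positivity) fun n => by positivity
  have hfin : ∑' q, P (E q) ≠ ∞ :=
    ne_top_of_le_ne_top hsum.tsum_ofReal_ne_top (ENNReal.tsum_le_tsum hE)
  filter_upwards [ae_finite_setOfPred_mem hfin] with ω hω
  obtain ⟨M, hM⟩ := (hω.image Prod.fst).bddAbove
  refine ⟨K, (eventually_gt_atTop M).mono fun N hN k hk => ?_⟩
  by_contra hcon
  exact hN.not_ge (hM ⟨(N, k), ⟨hk, hcon⟩, rfl⟩)

theorem exists_pos_mgf_lt_one [IsProbabilityMeasure P] {X : Ω → ℝ}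
    (hX : 0 ∈ interior (integrableExpSet X P)) (hneg : P[X] < 0) :
    ∃ s > 0, s ∈ integrableExpSet X P ∧ mgf X P s < 1 := by
  have hderiv : HasDerivAt (mgf X P) P[X] 0 := by simpa using hasDerivAt_mgf hX
  have hslope : ∀ᶠ s in 𝓝[>] (0 : ℝ), slope (mgf X P) 0 s < 0 :=
    (hderiv.tendsto_slope.mono_left (nhdsGT_le_nhdsNE 0)).eventually (gt_mem_nhds hneg)
  have hmem : ∀ᶠ s in 𝓝[>] (0 : ℝ), s ∈ integrableExpSet X P :=
    nhdsWithin_le_nhds (mem_interior_iff_mem_nhds.1 hX)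
  obtain ⟨s, hslope, hmem, hs⟩ := (hslope.and (hmem.and self_mem_nhdsWithin)).exists
  refine ⟨s, hs, hmem, ?_⟩
  rw [slope_def_field, sub_zero, mgf_zero, div_lt_iff₀ hs, zero_mul] at hslope
  exact sub_neg.1 hslope

theorem measure_sum_pos_le_mgf_pow {ι : Type*} {X : ι → Ω → ℝ} {X₀ : Ω → ℝ}
    (hind : iIndepFun X P) (hid : ∀ i, IdentDistrib (X i) X₀ P P) {s : ℝ} (hs : 0 ≤ s)
    (hint : s ∈ integrableExpSet X₀ P) (u : Finset ι) :
    P {ω | 0 < ∑ i ∈ u, X i ω} ≤ ENNReal.ofReal (mgf X₀ P s ^ u.card) := by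
  have := hind.isProbabilityMeasure
  have hmgf : mgf (∑ i ∈ u, X i) P s = mgf X₀ P s ^ u.card := by
    rw [hind.mgf_sum₀ fun i => (hid i).aemeasurable_fst]
    exact Finset.prod_eq_pow_card fun i _ => congrFun (mgf_congr_identDistrib (hid i)) s
  have hint' : s ∈ integrableExpSet (∑ i ∈ u, X i) P :=
    mgf_pos_iff.1 (hmgf ▸ pow_pos (mgf_pos hint) _)
  calc P {ω | 0 < ∑ i ∈ u, X i ω} ≤ P {ω | 0 ≤ (∑ i ∈ u, X i) ω} :=
        measure_mono fun ω h => by simpa using le_of_lt h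
    _ = ENNReal.ofReal (P.real {ω | 0 ≤ (∑ i ∈ u, X i) ω}) := (ofReal_measureReal).symm
    _ ≤ ENNReal.ofReal (mgf X₀ P s ^ u.card) :=
        ENNReal.ofReal_le_ofReal (by simpa [hmgf] using measure_ge_le_exp_mul_mgf 0 hs hint')

theorem ae_holdsAcrossLogGaps_sum_nonpos {X : ℕ → Ω → ℝ} {X₀ : Ω → ℝ}
    (hind : iIndepFun X P) (hid : ∀ n, IdentDistrib (X n) X₀ P P)
    (hX₀ : 0 ∈ interior (integrableExpSet X₀ P)) (hneg : P[X₀] < 0) :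
    ∀ᵐ ω ∂P, HoldsAcrossLogGaps fun N M => ∑ i ∈ Finset.Ico N M, X i ω ≤ 0 := by
  have := hind.isProbabilityMeasure
  obtain ⟨s, hs, hint, hlt⟩ := exists_pos_mgf_lt_one hX₀ hneg
  refine ae_holdsAcrossLogGaps_of_measure_le (mgf_pos hint) hlt fun N k => ?_
  simpa using measure_sum_pos_le_mgf_pow hind hid hs.le hint (Finset.Ico N (N + k))

end NegativeDrift

section Dimensions

variable {μ : Measure ℝ} {x d : ℝ}

theorem div_le_mul_rpow_iff_log {M m C R r : ℝ} (hM : 0 < M) (hm : 0 < m) (hC : 0 < C)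
    (hR : 0 < R) (hr : 0 < r) (d : ℝ) :
    M / m ≤ C * (R / r) ^ d ↔
      Real.log M - Real.log m ≤ Real.log C + d * (Real.log R - Real.log r) := by
  rw [← Real.log_le_log_iff (by positivity) (by positivity), Real.log_div hM.ne' hm.ne',
    Real.log_mul hC.ne' (by positivity), Real.log_rpow (by positivity), Real.log_div hR.ne' hr.ne']

theorem mul_rpow_le_div_iff_log {M m C R r : ℝ} (hM : 0 < M) (hm : 0 < m) (hC : 0 < C)
    (hR : 0 < R) (hr : 0 < r) (d : ℝ) :
    C * (R / r) ^ d ≤ M / m ↔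
      Real.log C + d * (Real.log R - Real.log r) ≤ Real.log M - Real.log m := by
  rw [← Real.log_le_log_iff (by positivity) (by positivity), Real.log_div hM.ne' hm.ne',
    Real.log_mul hC.ne' (by positivity), Real.log_rpow (by positivity), Real.log_div hR.ne' hr.ne']

theorem measureReal_ball_pos_of_mem_support [IsFiniteMeasure μ] (hx : x ∈ μ.support) {r : ℝ}
    (hr : 0 < r) : 0 < μ.real (Metric.ball x r) :=
  ENNReal.toReal_pos ((Measure.mem_support_iff_forall x).1 hx _ (Metric.ball_mem_nhds x hr)).ne'
    (measure_ne_top _ _)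

theorem tendsto_div_log_add_mul_log (c d : ℝ) :
    Tendsto (fun r : ℝ => (((c + d * Real.log r) / Real.log r : ℝ) : EReal)) (𝓝[>] 0)
      (𝓝 (d : EReal)) := by
  have hlog := Real.tendsto_log_nhdsGT_zero
  have h : Tendsto (fun r : ℝ => c / Real.log r + d) (𝓝[>] 0) (𝓝 d) := by
    simpa using (hlog.const_div_atBot c).add_const d
  refine (continuous_coe_real_ereal.tendsto d).comp (h.congr' ?_)
  filter_upwards [hlog.eventually_ne_atBot 0] with r hr
  rw [add_div, mul_div_cancel_right₀ d hr]

theorem upperLocalDim_le_of_eventually {c : ℝ}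
    (h : ∀ᶠ r in 𝓝[>] 0, c + d * Real.log r ≤ Real.log (μ.real (Metric.ball x r))) :
    upperLocalDim μ x ≤ d := by
  refine (limsup_le_limsup ?_).trans (tendsto_div_log_add_mul_log c d).limsup_eq.le
  filter_upwards [h, Real.tendsto_log_nhdsGT_zero.eventually_lt_atBot 0] with r hr hlog
  exact EReal.coe_le_coe_iff.2 (div_le_div_of_nonpos_of_le hlog.le hr)

theorem le_lowerLocalDim_of_eventually {c : ℝ}
    (h : ∀ᶠ r in 𝓝[>] 0, Real.log (μ.real (Metric.ball x r)) ≤ c + d * Real.log r) :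
    d ≤ lowerLocalDim μ x := by
  refine (tendsto_div_log_add_mul_log c d).liminf_eq.ge.trans (liminf_le_liminf ?_)
  filter_upwards [h, Real.tendsto_log_nhdsGT_zero.eventually_lt_atBot 0] with r hr hlog
  exact EReal.coe_le_coe_iff.2 (div_le_div_of_nonpos_of_le hlog.le hr)

theorem upperLocalDim_le_upperPhiDim [IsFiniteMeasure μ] (hx : x ∈ μ.support) (Φ : ℝ → ℝ) :
    upperLocalDim μ x ≤ upperPhiDim Φ μ := by
  refine le_sInf ?_
  rintro _ ⟨d, ⟨C₁, hC₁, C₂, hC₂, h⟩, rfl⟩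
  obtain ⟨R, hR0, hR⟩ := exists_between (lt_min hC₁ one_pos)
  obtain ⟨hRC, hR1⟩ := lt_min_iff.1 hR
  refine upperLocalDim_le_of_eventually
    (c := Real.log (μ.real (Metric.ball x R)) - Real.log C₂ - d * Real.log R) ?_
  filter_upwards [Ioo_mem_nhdsGT (Real.rpow_pos_of_pos hR0 (1 + Φ R))] with r ⟨hr0, hr⟩
  have := (div_le_mul_rpow_iff_log (measureReal_ball_pos_of_mem_support hx hR0)
    (measureReal_ball_pos_of_mem_support hx hr0) hC₂ hR0 hr0 d).1
    (h R r hR0 hR1 hRC.le hr0 hr x hx)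
  linarith

theorem lowerPhiDim_le_lowerLocalDim [IsFiniteMeasure μ] (hx : x ∈ μ.support) (Φ : ℝ → ℝ) :
    lowerPhiDim Φ μ ≤ lowerLocalDim μ x := by
  refine sSup_le ?_
  rintro _ ⟨d, ⟨C₁, hC₁, C₂, hC₂, h⟩, rfl⟩
  obtain ⟨R, hR0, hR⟩ := exists_between (lt_min hC₁ one_pos)
  obtain ⟨hRC, hR1⟩ := lt_min_iff.1 hR
  refine le_lowerLocalDim_of_eventually
    (c := Real.log (μ.real (Metric.ball x R)) - Real.log C₂ - d * Real.log R) ?_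
  filter_upwards [Ioo_mem_nhdsGT (Real.rpow_pos_of_pos hR0 (1 + Φ R))] with r ⟨hr0, hr⟩
  have := (mul_rpow_le_div_iff_log (measureReal_ball_pos_of_mem_support hx hR0)
    (measureReal_ball_pos_of_mem_support hx hr0) hC₂ hR0 hr0 d).1
    (h R r hR0 hR1 hRC.le hr0 hr x hx)
  linarith

theorem upperPhiDim_le_of_eventually [IsFiniteMeasure μ] {Φ : ℝ → ℝ} (c : ℝ)
    (h : ∀ᶠ R in 𝓝[>] 0, ∀ r, 0 < r → r < R ^ (1 + Φ R) → ∀ x ∈ μ.support,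
      Real.log (μ.real (Metric.ball x R)) - Real.log (μ.real (Metric.ball x r)) ≤
        c + d * (Real.log R - Real.log r)) :
    upperPhiDim Φ μ ≤ d := by
  obtain ⟨ε, hε, h⟩ := mem_nhdsGT_iff_exists_Ioc_subset.1 h
  refine sInf_le ⟨d, ⟨ε, hε, Real.exp c, Real.exp_pos c, ?_⟩, rfl⟩
  intro R r hR _ hRε hr hrR x hx
  rw [div_le_mul_rpow_iff_log (measureReal_ball_pos_of_mem_support hx hR)
    (measureReal_ball_pos_of_mem_support hx hr) (Real.exp_pos c) hR hr, Real.log_exp]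
  exact h ⟨hR, hRε⟩ r hr hrR x hx

theorem le_lowerPhiDim_of_eventually [IsFiniteMeasure μ] {Φ : ℝ → ℝ} (c : ℝ)
    (h : ∀ᶠ R in 𝓝[>] 0, ∀ r, 0 < r → r < R ^ (1 + Φ R) → ∀ x ∈ μ.support,
      c + d * (Real.log R - Real.log r) ≤
        Real.log (μ.real (Metric.ball x R)) - Real.log (μ.real (Metric.ball x r))) :
    d ≤ lowerPhiDim Φ μ := by
  obtain ⟨ε, hε, h⟩ := mem_nhdsGT_iff_exists_Ioc_subset.1 h
  refine le_sSup ⟨d, ⟨ε, hε, Real.exp c, Real.exp_pos c, ?_⟩, rfl⟩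
  intro R r hR _ hRε hr hrR x hx
  rw [mul_rpow_le_div_iff_log (measureReal_ball_pos_of_mem_support hx hR)
    (measureReal_ball_pos_of_mem_support hx hr) (Real.exp_pos c) hR hr, Real.log_exp]
  exact h ⟨hR, hRε⟩ r hr hrR x hx

theorem le_upperLocalDim_of_tendsto [IsFiniteMeasure μ] (hx : x ∈ μ.support) {ι : Type*}
    {l : Filter ι} [l.NeBot] {r m : ι → ℝ} (hr : Tendsto r l (𝓝[>] 0))
    (hm : ∀ᶠ i in l, μ.real (Metric.ball x (r i)) ≤ m i)
    (hd : Tendsto (fun i => Real.log (m i) / Real.log (r i)) l (𝓝 d)) :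
    d ≤ upperLocalDim μ x := by
  have hd' := (continuous_coe_real_ereal.tendsto d).comp hd
  refine hd'.limsup_eq.ge.trans (le_trans (limsup_le_limsup ?_) (limsup_le_limsup_of_le hr))
  filter_upwards [hm, hr.eventually self_mem_nhdsWithin,
    (Real.tendsto_log_nhdsGT_zero.comp hr).eventually_lt_atBot 0] with i hm hr hlog
  exact EReal.coe_le_coe_iff.2 (div_le_div_of_nonpos_of_le hlog.le
    (Real.log_le_log (measureReal_ball_pos_of_mem_support hx hr) hm))

theorem lowerLocalDim_le_of_tendsto {ι : Type*} {l : Filter ι} [l.NeBot] {r m : ι → ℝ}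
    (hr : Tendsto r l (𝓝[>] 0)) (hm0 : ∀ᶠ i in l, 0 < m i)
    (hm : ∀ᶠ i in l, m i ≤ μ.real (Metric.ball x (r i)))
    (hd : Tendsto (fun i => Real.log (m i) / Real.log (r i)) l (𝓝 d)) :
    lowerLocalDim μ x ≤ d := by
  have hd' := (continuous_coe_real_ereal.tendsto d).comp hd
  have hle : lowerLocalDim μ x ≤ liminf (fun i =>
      ((Real.log (μ.real (Metric.ball x (r i))) / Real.log (r i) : ℝ) : EReal)) l :=
    liminf_le_liminf_of_le hr
  refine hle.trans ((liminf_le_liminf ?_).trans hd'.liminf_eq.le)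
  filter_upwards [hm0, hm,
    (Real.tendsto_log_nhdsGT_zero.comp hr).eventually_lt_atBot 0] with i hm0 hm hlog
  exact EReal.coe_le_coe_iff.2 (div_le_div_of_nonpos_of_le hlog.le (Real.log_le_log hm0 hm))

end Dimensions

section DimensionFunctions

variable {Φ : ℝ → ℝ}

theorem tendsto_div_log_atTop : Tendsto (fun x : ℝ => x / Real.log x) atTop atTop := by
  have h : Tendsto (fun x : ℝ => Real.log x / x) atTop (𝓝[>] 0) :=
    tendsto_nhdsWithin_iff.2 ⟨Real.isLittleO_log_id_atTop.tendsto_div_nhds_zero,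
      (eventually_gt_atTop 1).mono fun x hx => div_pos (Real.log_pos hx) (one_pos.trans hx)⟩
  simpa only [Function.comp_def, inv_div] using tendsto_inv_nhdsGT_zero.comp h

theorem tendsto_abs_log_nhdsGT_zero : Tendsto (fun t : ℝ => |Real.log t|) (𝓝[>] 0) atTop :=
  tendsto_abs_atBot_atTop.comp Real.tendsto_log_nhdsGT_zero

theorem isDimensionFunction_const {c : ℝ} (hc : 0 ≤ c) : IsDimensionFunction fun _ => c where
  nonneg _ _ := hc
  monotoneOn _ hx _ _ hxy := Real.rpow_le_rpow hx.1.le hxy (by positivity)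
  tendsto_zero := by
    have hne : 1 + c ≠ 0 := by positivity
    have := (Real.continuousAt_rpow_const 0 (1 + c) (Or.inr (by positivity))).tendsto
    rw [Real.zero_rpow hne] at this
    exact this.mono_left nhdsWithin_le_nhds

theorem isLargeDimensionFunction_one : IsLargeDimensionFunction fun _ => 1 := by
  refine ⟨isDimensionFunction_const zero_le_one, fun t => |Real.log t| / Real.log |Real.log t|,
    tendsto_div_log_atTop.comp tendsto_abs_log_nhdsGT_zero, ?_⟩
  filter_upwards [tendsto_abs_log_nhdsGT_zero.eventually_gt_atTop 1] with t ht
  rw [div_mul_div_cancel₀ (Real.log_pos ht).ne', div_self (by positivity)]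

theorem IsDimensionFunction.rpow_le_self (hΦ : IsDimensionFunction Φ) {R : ℝ}
    (hR : R ∈ Ioo 0 1) : R ^ (1 + Φ R) ≤ R :=
  Real.rpow_le_self_of_le_one hR.1.le hR.2.le (by linarith [hΦ.nonneg R hR])

theorem IsLargeDimensionFunction.eventually_mul_log_abs_log_le (hΦ : IsLargeDimensionFunction Φ)
    (C : ℝ) : ∀ᶠ R in 𝓝[>] 0, ∀ r, 0 < r → r < R ^ (1 + Φ R) →
      C * Real.log |Real.log R| ≤ Real.log R - Real.log r := by
  obtain ⟨_, H, hH, hΦH⟩ := hΦ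
  filter_upwards [hH.eventually_ge_atTop C, hΦH,
    tendsto_abs_log_nhdsGT_zero.eventually_gt_atTop 1,
    Ioo_mem_nhdsGT one_pos] with R hCH hΦR hlog ⟨hR0, hR1⟩ r hr hrR
  have hr' : Real.log r ≤ (1 + Φ R) * Real.log R := by
    rw [← Real.log_rpow hR0]
    exact Real.log_le_log hr hrR.le
  have habs : |Real.log R| = -Real.log R := abs_of_neg (Real.log_neg hR0 hR1)
  calc C * Real.log |Real.log R| ≤ H R * Real.log |Real.log R| := by
        gcongr
        exact (Real.log_pos hlog).le
    _ = Φ R * |Real.log R| := by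
        rw [hΦR, mul_assoc, div_mul_cancel₀ _ (by positivity)]
    _ ≤ Real.log R - Real.log r := by rw [habs]; linarith

end DimensionFunctions

section MoranGeometry

/-- Uniform bounds on the contraction ratios of a Moran construction: children have relative length
at least `A`, and siblings leave a gap of relative length at least `1 - B`. -/
structure MoranRatioBounds (A B : ℝ) (a b : ℕ → ℝ) : Prop where
  A_pos : 0 < A
  B_lt_one : B < 1
  A_le_a : ∀ n, A ≤ a n
  A_le_b : ∀ n, A ≤ b n
  add_le_B : ∀ n, a n + b n ≤ B

instance isProbabilityMeasure_moranMeasure (a b : ℕ → ℝ) (p : ℕ → unitInterval) :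
    IsProbabilityMeasure (moranMeasure a b p) :=
  Measure.isProbabilityMeasure_map (measurable_moranPoint a b).aemeasurable

theorem abs_log_sub_log_le {c x y : ℝ} (hc : 0 < c) (hx : 0 < x) (hy : 0 < y) (hxy : c * x ≤ y)
    (hyx : c * y ≤ x) : |Real.log x - Real.log y| ≤ -Real.log c := by
  have hxy := Real.log_le_log (by positivity) hxy
  have hyx := Real.log_le_log (by positivity) hyx
  rw [Real.log_mul hc.ne' (by positivity)] at hxy hyx
  rw [abs_le]
  constructor <;> linarith

namespace MoranRatioBounds

variable {A B : ℝ} {a b : ℕ → ℝ} {p : ℕ → unitInterval} {v w : ℕ → Bool} {n : ℕ} {r : ℝ}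

section Lengths

variable (h : MoranRatioBounds A B a b)
include h

theorem a_pos (n : ℕ) : 0 < a n := h.A_pos.trans_le (h.A_le_a n)

theorem b_pos (n : ℕ) : 0 < b n := h.A_pos.trans_le (h.A_le_b n)

theorem add_lt_one (n : ℕ) : a n + b n < 1 := (h.add_le_B n).trans_lt h.B_lt_one

theorem B_pos : 0 < B := (add_pos (h.a_pos 0) (h.b_pos 0)).trans_le (h.add_le_B 0)

theorem A_lt_one : A < 1 := by linarith [h.A_le_a 0, h.b_pos 0, h.add_lt_one 0]

theorem neg_log_A_pos : 0 < -Real.log A := neg_pos.2 (Real.log_neg h.A_pos h.A_lt_one)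

theorem neg_log_one_sub_A_pos : 0 < -Real.log (1 - A) :=
  neg_pos.2 (Real.log_neg (by linarith [h.A_lt_one]) (by linarith [h.A_pos]))

theorem ratio_mem (n : ℕ) (c : Bool) : (if c then b n else a n) ∈ Icc A (1 - A) := by
  have ha := h.A_le_a n
  have hb := h.A_le_b n
  have hab := h.add_lt_one n
  split_ifs <;> constructor <;> linarith

theorem length_pos (v : ℕ → Bool) (n : ℕ) : 0 < moranLength a b v n :=
  moranLength_pos h.a_pos h.b_pos v n

theorem mul_length_le_length_succ (v : ℕ → Bool) (n : ℕ) :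
    A * moranLength a b v n ≤ moranLength a b v (n + 1) :=
  mul_le_mul_of_nonneg_right (h.ratio_mem n (v n)).1 (h.length_pos v n).le

theorem length_succ_le (v : ℕ → Bool) (n : ℕ) :
    moranLength a b v (n + 1) ≤ (1 - A) * moranLength a b v n :=
  mul_le_mul_of_nonneg_right (h.ratio_mem n (v n)).2 (h.length_pos v n).le

theorem length_antitone (v : ℕ → Bool) : Antitone (moranLength a b v) :=
  antitone_nat_of_succ_le fun n => (h.length_succ_le v n).trans
    (mul_le_of_le_one_left (h.length_pos v n).le (by linarith [h.A_pos]))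

theorem log_length_sub_le (v : ℕ → Bool) (N k : ℕ) :
    Real.log (moranLength a b v N) - Real.log (moranLength a b v (N + k)) ≤
      k * -Real.log A := by
  induction k with
  | zero => simp
  | succ k ih =>
    have hstep := Real.log_le_log (mul_pos h.A_pos (h.length_pos v (N + k)))
      (h.mul_length_le_length_succ v (N + k))
    rw [Real.log_mul h.A_pos.ne' (h.length_pos v _).ne'] at hstep
    rw [← add_assoc]
    push_cast
    linarith

theorem le_log_length_sub (v : ℕ → Bool) (N k : ℕ) :
    k * -Real.log (1 - A) ≤
      Real.log (moranLength a b v N) - Real.log (moranLength a b v (N + k)) := by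
  induction k with
  | zero => simp
  | succ k ih =>
    have hstep := Real.log_le_log (h.length_pos v _) (h.length_succ_le v (N + k))
    rw [Real.log_mul (by linarith [h.A_lt_one]) (h.length_pos v _).ne'] at hstep
    rw [← add_assoc]
    push_cast
    linarith

theorem neg_log_length_le (v : ℕ → Bool) (n : ℕ) :
    -Real.log (moranLength a b v n) ≤ n * -Real.log A := by
  simpa [moranLength] using h.log_length_sub_le v 0 n

theorem le_neg_log_length (v : ℕ → Bool) (n : ℕ) :
    n * -Real.log (1 - A) ≤ -Real.log (moranLength a b v n) := by
  simpa [moranLength] using h.le_log_length_sub v 0 n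

theorem tendsto_length (v : ℕ → Bool) : Tendsto (moranLength a b v) atTop (𝓝[>] 0) := by
  refine tendsto_nhdsWithin_iff.2 ⟨?_, .of_forall (h.length_pos v)⟩
  refine squeeze_zero (fun n => (h.length_pos v n).le) (fun n => ?_)
    (tendsto_pow_atTop_nhds_zero_of_lt_one (r := 1 - A) (by linarith [h.A_lt_one])
      (by linarith [h.A_pos]))
  induction n with
  | zero => simp [moranLength]
  | succ n ih =>
    rw [pow_succ']
    exact (h.length_succ_le v n).trans
      (mul_le_mul_of_nonneg_left ih (by linarith [h.A_lt_one]))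

theorem exists_length_lt (v : ℕ → Bool) (hr : 0 < r) : ∃ n, moranLength a b v n < r :=
  ((h.tendsto_length v).eventually (nhdsWithin_le_nhds (gt_mem_nhds hr))).exists

theorem exists_length_succ_lt_le_length (v : ℕ → Bool) (hr : 0 < r) (hr1 : r ≤ 1) :
    ∃ n, moranLength a b v (n + 1) < r ∧ r ≤ moranLength a b v n := by
  have hex := h.exists_length_lt v hr
  obtain ⟨n, hn⟩ : ∃ n, Nat.find hex = n + 1 :=
    Nat.exists_eq_add_one.2 ((Nat.find_pos hex).2 (by simpa [moranLength] using hr1))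
  exact ⟨n, hn ▸ Nat.find_spec hex, not_lt.1 (Nat.find_min hex (by omega))⟩

end Lengths

section Points

variable (h : MoranRatioBounds A B a b)
include h

theorem point_mem (v : ℕ → Bool) (n : ℕ) : moranPoint a b v ∈ moranInterval a b v n :=
  moranPoint_mem h.a_pos h.b_pos h.add_lt_one v n

omit h in
theorem interval_congr (hvw : ∀ i < n, v i = w i) :
    moranInterval a b v n = moranInterval a b w n := by
  obtain ⟨hleft, hlength⟩ := moranLeft_length_congr (a := a) (b := b) hvw
  rw [moranInterval, moranInterval, hleft, hlength]

theorem dist_point_le (hvw : ∀ i < n, v i = w i) :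
    dist (moranPoint a b w) (moranPoint a b v) ≤ moranLength a b v n := by
  have hw := h.point_mem w n
  rw [← interval_congr hvw] at hw
  simpa using Real.dist_le_of_mem_Icc hw (h.point_mem v n)

theorem le_dist_point (hvw : ∀ i < n, v i = w i) (hn : v n ≠ w n) :
    (1 - B) * moranLength a b v n ≤ dist (moranPoint a b w) (moranPoint a b v) := by
  obtain ⟨hleft, hlength⟩ := moranLeft_length_congr (a := a) (b := b) hvw
  have hv := h.point_mem v (n + 1)
  have hw := h.point_mem w (n + 1)
  have hB := mul_le_mul_of_nonneg_right (h.add_le_B n) (h.length_pos v n).le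
  simp only [moranInterval, moranLeft, moranLength, mem_Icc, ← hleft, ← hlength] at hv hw
  rw [Real.dist_eq]
  cases hvn : v n <;> cases hwn : w n <;>
    simp only [hvn, hwn, ne_eq, not_true_eq_false, Bool.false_eq_true, if_true, if_false]
      at hv hw hn
  · exact le_trans (by linarith) (le_abs_self _)
  · exact le_trans (by linarith) (neg_le_abs _)

theorem continuous_point : Continuous (moranPoint a b) := by
  refine continuous_iff_continuousAt.2 fun v => Metric.tendsto_nhds.2 fun ε hε => ?_
  obtain ⟨n, hn⟩ := h.exists_length_lt v hε
  have hagree : ∀ᶠ w in 𝓝 v, ∀ i ∈ Finset.range n, w i = v i :=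
    (Finset.eventually_all _).2 fun i _ =>
      (continuous_apply i).continuousAt.eventually_mem (mem_nhds_discrete.2 rfl : {v i} ∈ 𝓝 (v i))
  filter_upwards [hagree] with w hw
  exact (h.dist_point_le fun i hi => (hw i (Finset.mem_range.2 hi)).symm).trans_lt hn

theorem eq_of_dist_point_lt
    (hdist : dist (moranPoint a b w) (moranPoint a b v) < (1 - B) * moranLength a b v n) :
    ∀ i < n, v i = w i := by
  intro i
  induction i using Nat.strong_induction_on with
  | _ i ih =>
    intro hi
    by_contra hne
    have hle := h.le_dist_point (fun j hj => ih j hj (hj.trans hi)) hne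
    have hanti := mul_le_mul_of_nonneg_left (h.length_antitone v hi.le) (sub_nonneg.2 h.B_lt_one.le)
    linarith

end Points

section Mass

variable (h : MoranRatioBounds A B a b)
include h

theorem measureReal_ball_le (v : ℕ → Bool) (hr : r ≤ (1 - B) * moranLength a b v n) :
    (moranMeasure a b p).real (Metric.ball (moranPoint a b v) r) ≤
      (moranMeasure a b p).real (moranInterval a b v n) := by
  have hm := measurable_moranPoint a b
  rw [moranMeasure, moranInterval, map_measureReal_apply hm measurableSet_ball,
    map_measureReal_apply hm measurableSet_Icc]
  refine measureReal_mono fun w hw => ?_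
  rw [mem_preimage, ← moranInterval, interval_congr (h.eq_of_dist_point_lt (lt_of_lt_of_le hw hr))]
  exact h.point_mem w n

theorem measureReal_interval_le_ball (v : ℕ → Bool) (hr : moranLength a b v n < r) :
    (moranMeasure a b p).real (moranInterval a b v n) ≤
      (moranMeasure a b p).real (Metric.ball (moranPoint a b v) r) := by
  refine measureReal_mono fun y hy => Metric.mem_ball.2 (lt_of_le_of_lt ?_ hr)
  simpa using Real.dist_le_of_mem_Icc hy (h.point_mem v n)

theorem exists_measureReal_ball_le_interval (v : ℕ → Bool) (hr : 0 < r) (hrB : r ≤ 1 - B) :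
    ∃ n, |Real.log (moranLength a b v n) - Real.log r| ≤ -Real.log (A * (1 - B)) ∧
      (moranMeasure a b p).real (Metric.ball (moranPoint a b v) r) ≤
        (moranMeasure a b p).real (moranInterval a b v n) := by
  have hB : 0 < 1 - B := sub_pos.2 h.B_lt_one
  obtain ⟨n, hlt, hle⟩ :=
    h.exists_length_succ_lt_le_length v (div_pos hr hB) ((div_le_one hB).2 hrB)
  rw [lt_div_iff₀ hB] at hlt
  rw [div_le_iff₀' hB] at hle
  refine ⟨n, abs_log_sub_log_le (mul_pos h.A_pos hB) (h.length_pos v n) hr ?_ ?_,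
    h.measureReal_ball_le v hle⟩
  · nlinarith [h.mul_length_le_length_succ v n]
  · have hAB : A * (1 - B) ≤ 1 := by nlinarith [h.A_pos, h.A_lt_one, h.B_pos]
    nlinarith [h.length_pos v n, h.B_pos]

theorem exists_measureReal_interval_le_ball (v : ℕ → Bool) (hr : 0 < r) (hr1 : r ≤ 1) :
    ∃ n, |Real.log (moranLength a b v n) - Real.log r| ≤ -Real.log (A * (1 - B)) ∧
      (moranMeasure a b p).real (moranInterval a b v n) ≤
        (moranMeasure a b p).real (Metric.ball (moranPoint a b v) r) := by
  have hB : 0 < 1 - B := sub_pos.2 h.B_lt_one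
  have hAB : A * (1 - B) ≤ A := mul_le_of_le_one_right h.A_pos.le (by linarith [h.B_pos])
  obtain ⟨n, hlt, hle⟩ := h.exists_length_succ_lt_le_length v hr hr1
  have hpos := h.length_pos v (n + 1)
  refine ⟨n + 1, abs_log_sub_log_le (mul_pos h.A_pos hB) hpos hr ?_ ?_,
    h.measureReal_interval_le_ball v hlt⟩
  · exact (mul_le_of_le_one_left hpos.le (hAB.trans h.A_lt_one.le)).trans hlt.le
  · exact (mul_le_mul hAB hle hr.le h.A_pos.le).trans (h.mul_length_le_length_succ v n)

theorem measureReal_interval (v : ℕ → Bool) (n : ℕ) :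
    (moranMeasure a b p).real (moranInterval a b v n) =
      ∏ i ∈ Finset.range n, if v i then 1 - (p i : ℝ) else p i := by
  rw [measureReal_def, moranMeasure_moranInterval h.a_pos h.b_pos h.add_lt_one, ENNReal.toReal_prod]
  refine Finset.prod_congr rfl fun i _ => ENNReal.toReal_ofReal ?_
  split_ifs
  exacts [sub_nonneg.2 (p i).2.2, (p i).2.1]

theorem measureReal_interval_pos (hp : ∀ n, (p n : ℝ) ∈ Ioo 0 1) (v : ℕ → Bool) (n : ℕ) :
    0 < (moranMeasure a b p).real (moranInterval a b v n) := by
  rw [h.measureReal_interval]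
  refine Finset.prod_pos fun i _ => ?_
  split_ifs
  exacts [sub_pos.2 (hp i).2, (hp i).1]

theorem support_eq_range (hp : ∀ n, (p n : ℝ) ∈ Ioo 0 1) :
    (moranMeasure a b p).support = range (moranPoint a b) := by
  have hclosed := (isCompact_range h.continuous_point).isClosed
  apply Subset.antisymm
  · refine Measure.support_subset_of_isClosed hclosed ?_
    rw [moranMeasure, mem_ae_map_iff (measurable_moranPoint a b).aemeasurable hclosed.measurableSet,
      preimage_range]
    exact univ_mem
  · rintro _ ⟨v, rfl⟩
    refine (Measure.mem_support_iff_forall _).2 fun U hU => ?_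
    obtain ⟨r, hr, hrU⟩ := Metric.mem_nhds_iff.1 hU
    obtain ⟨n, hn⟩ := h.exists_length_lt v hr
    have hball := (h.measureReal_interval_pos hp v n).trans_le (h.measureReal_interval_le_ball v hn)
    exact (ENNReal.toReal_pos_iff.1 hball).1.trans_le (measure_mono hrU)

end Mass

end MoranRatioBounds

end MoranGeometry

section ScalingDefect

/-- The contribution of one step of a Moran construction with ratios and weight `((a, b), p)` to
`logScalingDefect`, when the child `c` is chosen. -/
noncomputable def moranStep (d : ℝ) (x : (ℝ × ℝ) × unitInterval) (c : Bool) : ℝ :=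
  d * Real.log (if c then x.1.2 else x.1.1) - Real.log (if c then 1 - (x.2 : ℝ) else x.2)

/-- The failure of the level `n` Moran interval `I` along `v` to satisfy `μ I = |I| ^ d`, measured
as `log (|I| ^ d / μ I)`. -/
noncomputable def logScalingDefect (a b : ℕ → ℝ) (p : ℕ → unitInterval) (d : ℝ) (v : ℕ → Bool)
    (n : ℕ) : ℝ :=
  d * Real.log (moranLength a b v n) - Real.log ((moranMeasure a b p).real (moranInterval a b v n))

theorem eventually_log_add_one_le {β : ℝ} (hβ : 0 < β) (c : ℝ) :
    ∀ᶠ y : ℝ in atTop, ∀ N : ℕ, N * β ≤ y + c → Real.log (N + 1) ≤ 2 * Real.log y := by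
  filter_upwards [eventually_ge_atTop 1, eventually_ge_atTop ((1 + |c|) / β + 1)]
    with y hy1 hy N hN
  have hNy : (N : ℝ) + 1 ≤ y ^ 2 := by
    have hNβ : (N : ℝ) ≤ (1 + |c|) / β * y := by
      rw [div_mul_eq_mul_div, le_div_iff₀ hβ]
      nlinarith [le_abs_self c, abs_nonneg c]
    nlinarith
  simpa using Real.log_le_log (by positivity) hNy

theorem abs_mul_sub_sub_mul_sub_le (d : ℝ) {c x y x' y' : ℝ} (hx : |x - x'| ≤ c)
    (hy : |y - y'| ≤ c) : |d * (x - y) - d * (x' - y')| ≤ |d| * (2 * c) := by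
  rw [← mul_sub, sub_sub_sub_comm, abs_mul, two_mul]
  gcongr
  exact (abs_sub _ _).trans (add_le_add hx hy)

namespace MoranRatioBounds

variable {A B : ℝ} {a b : ℕ → ℝ} {p : ℕ → unitInterval} {v : ℕ → Bool} {Φ : ℝ → ℝ} {d θ : ℝ}
  (h : MoranRatioBounds A B a b)
include h

theorem logScalingDefect_eq_sum (hp : ∀ n, (p n : ℝ) ∈ Ioo 0 1) (d : ℝ) (v : ℕ → Bool) (n : ℕ) :
    logScalingDefect a b p d v n =
      ∑ i ∈ Finset.range n, moranStep d ((a i, b i), p i) (v i) := by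
  induction n with
  | zero => simp [logScalingDefect, moranLength, h.measureReal_interval]
  | succ n ih =>
    have hratio : (if v n then b n else a n) ≠ 0 := (h.A_pos.trans_le (h.ratio_mem n (v n)).1).ne'
    have hweight : (if v n then 1 - (p n : ℝ) else p n) ≠ 0 := by
      split_ifs
      exacts [(sub_pos.2 (hp n).2).ne', (hp n).1.ne']
    rw [Finset.sum_range_succ, ← ih, logScalingDefect, logScalingDefect, h.measureReal_interval,
      Finset.prod_range_succ, ← h.measureReal_interval, moranLength,
      Real.log_mul hratio (h.length_pos v n).ne',
      Real.log_mul (h.measureReal_interval_pos hp v n).ne' hweight, moranStep]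
    ring

theorem eventually_of_holdsAcrossLogGaps (hΦ : IsLargeDimensionFunction Φ) {Q : ℕ → ℕ → Prop}
    (hQ : HoldsAcrossLogGaps Q) (c : ℝ) :
    ∀ᶠ R in 𝓝[>] 0, ∀ r, 0 < r → r < R ^ (1 + Φ R) → ∀ v N M,
      |Real.log (moranLength a b v N) - Real.log R| ≤ c →
        |Real.log (moranLength a b v M) - Real.log r| ≤ c → Q N M := by
  obtain ⟨K, hK⟩ := hQ
  obtain ⟨N₀, hN₀⟩ := eventually_atTop.1 hK
  have hα := h.neg_log_A_pos
  set α := -Real.log A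
  filter_upwards [hΦ.eventually_mul_log_abs_log_le (2 * (α * |K|) + 2 * |c| + 1),
    tendsto_abs_log_nhdsGT_zero.eventually
      (eventually_log_add_one_le h.neg_log_one_sub_A_pos c),
    tendsto_abs_log_nhdsGT_zero.eventually_ge_atTop (N₀ * α + c),
    (Real.tendsto_log_atTop.comp tendsto_abs_log_nhdsGT_zero).eventually_ge_atTop 1,
    Ioo_mem_nhdsGT one_pos] with R hgap hlevel hlarge hlog ⟨hR0, hR1⟩ r hr hrR v N M hN hM
  specialize hgap r hr hrR
  have habs : |Real.log R| = -Real.log R := abs_of_neg (Real.log_neg hR0 hR1)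
  rw [Function.comp_apply] at hlog
  rw [abs_le] at hN hM
  have hNlog := hlevel N (by linarith [h.le_neg_log_length v N])
  have hNlarge : N₀ ≤ N := by
    have : (N₀ : ℝ) * α ≤ N * α := by linarith [h.neg_log_length_le v N]
    exact_mod_cast le_of_mul_le_mul_right this hα
  have hgap' : 2 * (α * |K|) * Real.log |Real.log R| <
      Real.log (moranLength a b v N) - Real.log (moranLength a b v M) := by
    nlinarith [le_abs_self c, abs_nonneg c]
  have hNM : N ≤ M := by
    by_contra! hlt
    have := Real.log_le_log (h.length_pos v N) (h.length_antitone v hlt.le)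
    have : 0 ≤ 2 * (α * |K|) * Real.log |Real.log R| := by positivity
    linarith
  obtain ⟨k, rfl⟩ := Nat.exists_eq_add_of_le hNM
  refine hN₀ N hNlarge k (le_of_mul_le_mul_right ?_ hα)
  calc K * Real.log (N + 1) * α ≤ |K| * (2 * Real.log |Real.log R|) * α := by
        gcongr
        exacts [Real.log_nonneg (by simp), le_abs_self K]
    _ ≤ k * α := by linarith [h.log_length_sub_le v N k]

theorem upperPhiDim_le (hp : ∀ n, (p n : ℝ) ∈ Ioo 0 1) (hΦ : IsLargeDimensionFunction Φ)
    (hQ : HoldsAcrossLogGaps fun N M =>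
      ∀ v, logScalingDefect a b p d v M ≤ logScalingDefect a b p d v N) :
    upperPhiDim Φ (moranMeasure a b p) ≤ d := by
  have hB : 0 < 1 - B := sub_pos.2 h.B_lt_one
  refine upperPhiDim_le_of_eventually (|d| * (2 * -Real.log (A * (1 - B)))) ?_
  filter_upwards [h.eventually_of_holdsAcrossLogGaps hΦ hQ (-Real.log (A * (1 - B))),
    Ioo_mem_nhdsGT one_pos, Ioo_mem_nhdsGT hB] with R hR hR1 hRB r hr hrR x hx
  obtain ⟨v, rfl⟩ := (h.support_eq_range hp).subset hx
  have hr1 := (hrR.trans_le (hΦ.1.rpow_le_self hR1)).trans hR1.2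
  obtain ⟨N, hN, hballR⟩ := h.exists_measureReal_ball_le_interval (p := p) v hR1.1 hRB.2.le
  obtain ⟨M, hM, hballr⟩ := h.exists_measureReal_interval_le_ball (p := p) v hr hr1.le
  have hdefect := hR r hr hrR v N M hN hM v
  have hballR := Real.log_le_log (measureReal_ball_pos_of_mem_support hx hR1.1) hballR
  have hballr := Real.log_le_log (h.measureReal_interval_pos hp v M) hballr
  have hdist := (abs_le.1 (abs_mul_sub_sub_mul_sub_le d hN hM)).2
  simp only [logScalingDefect] at hdefect
  linarith

theorem le_lowerPhiDim (hp : ∀ n, (p n : ℝ) ∈ Ioo 0 1) (hΦ : IsLargeDimensionFunction Φ)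
    (hQ : HoldsAcrossLogGaps fun N M =>
      ∀ v, logScalingDefect a b p d v N ≤ logScalingDefect a b p d v M) :
    d ≤ lowerPhiDim Φ (moranMeasure a b p) := by
  have hB : 0 < 1 - B := sub_pos.2 h.B_lt_one
  refine le_lowerPhiDim_of_eventually (-(|d| * (2 * -Real.log (A * (1 - B))))) ?_
  filter_upwards [h.eventually_of_holdsAcrossLogGaps hΦ hQ (-Real.log (A * (1 - B))),
    Ioo_mem_nhdsGT one_pos, Ioo_mem_nhdsGT hB] with R hR hR1 hRB r hr hrR x hx
  obtain ⟨v, rfl⟩ := (h.support_eq_range hp).subset hx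
  have hrB := (hrR.trans_le (hΦ.1.rpow_le_self hR1)).trans hRB.2
  obtain ⟨N, hN, hballR⟩ := h.exists_measureReal_interval_le_ball (p := p) v hR1.1 hR1.2.le
  obtain ⟨M, hM, hballr⟩ := h.exists_measureReal_ball_le_interval (p := p) v hr hrB.le
  have hdefect := hR r hr hrR v N M hN hM v
  have hballR := Real.log_le_log (h.measureReal_interval_pos hp v N) hballR
  have hballr := Real.log_le_log (measureReal_ball_pos_of_mem_support hx hr) hballr
  have hdist := (abs_le.1 (abs_mul_sub_sub_mul_sub_le d hN hM)).1
  simp only [logScalingDefect] at hdefect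
  linarith

theorem tendsto_log_measureReal_div_log {κ : ℝ} (hκ : 0 < κ)
    (hv : logScalingDefect a b p θ v =o[atTop] fun n : ℕ => (n : ℝ)) :
    Tendsto (fun n => Real.log ((moranMeasure a b p).real (moranInterval a b v n)) /
      Real.log (κ * moranLength a b v n)) atTop (𝓝 θ) := by
  have hβ := h.neg_log_one_sub_A_pos
  have hlog : ∀ n, Real.log (κ * moranLength a b v n) =
      Real.log κ + Real.log (moranLength a b v n) := fun n =>
    Real.log_mul hκ.ne' (h.length_pos v n).ne'
  have hlarge : ∀ᶠ n : ℕ in atTop,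
      n * (-Real.log (1 - A) / 2) ≤ -Real.log (κ * moranLength a b v n) := by
    filter_upwards [(tendsto_natCast_atTop_atTop.atTop_mul_const
      (half_pos hβ)).eventually_ge_atTop (Real.log κ)] with n hn
    linarith [h.le_neg_log_length v n, hlog n]
  have hne : ∀ᶠ n : ℕ in atTop, Real.log (κ * moranLength a b v n) ≠ 0 := by
    filter_upwards [hlarge, eventually_gt_atTop 0] with n hn hn0
    have : 0 < n * (-Real.log (1 - A) / 2) := by positivity
    linarith
  have hO : (fun n : ℕ => (n : ℝ)) =O[atTop] fun n => Real.log (κ * moranLength a b v n) := by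
    refine .of_bound (-Real.log (1 - A) / 2)⁻¹ (hlarge.mono fun n hn => ?_)
    rw [Real.norm_natCast, inv_mul_eq_div, le_div_iff₀ (half_pos hβ)]
    exact hn.trans (neg_le_abs _)
  have ho : (fun n => logScalingDefect a b p θ v n + θ * Real.log κ) =o[atTop]
      fun n : ℕ => (n : ℝ) :=
    hv.add (Asymptotics.isLittleO_const_left.2 (.inr
      (tendsto_norm_atTop_atTop.comp tendsto_natCast_atTop_atTop)))
  have hlim := (ho.trans_isBigO hO).tendsto_div_nhds_zero.const_sub θ
  rw [sub_zero] at hlim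
  refine hlim.congr' (hne.mono fun n hn => ?_)
  rw [eq_div_iff hn, sub_mul, div_mul_cancel₀ _ hn, logScalingDefect, hlog]
  ring

theorem tendsto_mul_length {κ : ℝ} (hκ : 0 < κ) (v : ℕ → Bool) :
    Tendsto (fun n => κ * moranLength a b v n) atTop (𝓝[>] 0) := by
  refine tendsto_nhdsWithin_iff.2 ⟨?_, .of_forall fun n => mul_pos hκ (h.length_pos v n)⟩
  simpa using ((h.tendsto_length v).mono_right nhdsWithin_le_nhds).const_mul κ

theorem le_upperLocalDim (hp : ∀ n, (p n : ℝ) ∈ Ioo 0 1)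
    (hv : logScalingDefect a b p θ v =o[atTop] fun n : ℕ => (n : ℝ)) :
    θ ≤ upperLocalDim (moranMeasure a b p) (moranPoint a b v) := by
  have hB : 0 < 1 - B := sub_pos.2 h.B_lt_one
  exact le_upperLocalDim_of_tendsto ((h.support_eq_range hp).symm ▸ mem_range_self v)
    (h.tendsto_mul_length hB v) (.of_forall fun n => h.measureReal_ball_le v le_rfl)
    (h.tendsto_log_measureReal_div_log hB hv)

theorem lowerLocalDim_le (hp : ∀ n, (p n : ℝ) ∈ Ioo 0 1)
    (hv : logScalingDefect a b p θ v =o[atTop] fun n : ℕ => (n : ℝ)) :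
    lowerLocalDim (moranMeasure a b p) (moranPoint a b v) ≤ θ :=
  lowerLocalDim_le_of_tendsto (h.tendsto_mul_length two_pos v)
    (.of_forall (h.measureReal_interval_pos hp v))
    (.of_forall fun n => h.measureReal_interval_le_ball v (by linarith [h.length_pos v n]))
    (h.tendsto_log_measureReal_div_log two_pos hv)

theorem sSup_upperLocalDim_eq_and_upperPhiDim_eq (hp : ∀ n, (p n : ℝ) ∈ Ioo 0 1) {u : ℕ → ℝ}
    (hu : Tendsto u atTop (𝓝 θ))
    (hQ : ∀ k, HoldsAcrossLogGaps fun N M =>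
      ∀ v, logScalingDefect a b p (u k) v M ≤ logScalingDefect a b p (u k) v N)
    (hv : logScalingDefect a b p θ v =o[atTop] fun n : ℕ => (n : ℝ)) :
    sSup (upperLocalDim (moranMeasure a b p) '' (moranMeasure a b p).support) = θ ∧
      ∀ Φ, IsLargeDimensionFunction Φ → upperPhiDim Φ (moranMeasure a b p) = θ := by
  have hle : ∀ Φ, IsLargeDimensionFunction Φ → upperPhiDim Φ (moranMeasure a b p) ≤ θ := fun Φ hΦ =>
    ge_of_tendsto' ((continuous_coe_real_ereal.tendsto θ).comp hu)
      fun k => h.upperPhiDim_le hp hΦ (hQ k)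
  have hlocal : ∀ Φ, sSup (upperLocalDim (moranMeasure a b p) '' (moranMeasure a b p).support) ≤
      upperPhiDim Φ (moranMeasure a b p) := fun Φ =>
    sSup_le (forall_mem_image.2 fun x hx => upperLocalDim_le_upperPhiDim hx Φ)
  have hge : (θ : EReal) ≤
      sSup (upperLocalDim (moranMeasure a b p) '' (moranMeasure a b p).support) :=
    (h.le_upperLocalDim hp hv).trans (le_sSup
      (mem_image_of_mem _ ((h.support_eq_range hp).symm ▸ mem_range_self v)))
  exact ⟨((hlocal _).trans (hle _ isLargeDimensionFunction_one)).antisymm hge,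
    fun Φ hΦ => (hle Φ hΦ).antisymm (hge.trans (hlocal Φ))⟩

theorem sInf_lowerLocalDim_eq_and_lowerPhiDim_eq (hp : ∀ n, (p n : ℝ) ∈ Ioo 0 1) {u : ℕ → ℝ}
    (hu : Tendsto u atTop (𝓝 θ))
    (hQ : ∀ k, HoldsAcrossLogGaps fun N M =>
      ∀ v, logScalingDefect a b p (u k) v N ≤ logScalingDefect a b p (u k) v M)
    (hv : logScalingDefect a b p θ v =o[atTop] fun n : ℕ => (n : ℝ)) :
    sInf (lowerLocalDim (moranMeasure a b p) '' (moranMeasure a b p).support) = θ ∧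
      ∀ Φ, IsLargeDimensionFunction Φ → lowerPhiDim Φ (moranMeasure a b p) = θ := by
  have hge : ∀ Φ, IsLargeDimensionFunction Φ → θ ≤ lowerPhiDim Φ (moranMeasure a b p) := fun Φ hΦ =>
    le_of_tendsto' ((continuous_coe_real_ereal.tendsto θ).comp hu)
      fun k => h.le_lowerPhiDim hp hΦ (hQ k)
  have hlocal : ∀ Φ, lowerPhiDim Φ (moranMeasure a b p) ≤
      sInf (lowerLocalDim (moranMeasure a b p) '' (moranMeasure a b p).support) := fun Φ =>
    le_sInf (forall_mem_image.2 fun x hx => lowerPhiDim_le_lowerLocalDim hx Φ)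
  have hle : sInf (lowerLocalDim (moranMeasure a b p) '' (moranMeasure a b p).support) ≤ θ :=
    (sInf_le (mem_image_of_mem _ ((h.support_eq_range hp).symm ▸ mem_range_self v))).trans
      (h.lowerLocalDim_le hp hv)
  exact ⟨hle.antisymm ((hge _ isLargeDimensionFunction_one).trans (hlocal _)),
    fun Φ hΦ => ((hlocal Φ).trans hle).antisymm (hge Φ hΦ)⟩

end MoranRatioBounds

end ScalingDefect

section ExtremalStep

variable {A d θ σ t u : ℝ} {x : (ℝ × ℝ) × unitInterval}

/-- The maximum over the two children of `moranStep d` if `σ = 1`, and minus the minimum if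
`σ = -1`. -/
noncomputable def extremalStep (σ d : ℝ) (x : (ℝ × ℝ) × unitInterval) : ℝ :=
  max (σ * moranStep d x false) (σ * moranStep d x true)

theorem mul_moranStep_le_extremalStep (σ d : ℝ) (x : (ℝ × ℝ) × unitInterval) (c : Bool) :
    σ * moranStep d x c ≤ extremalStep σ d x := by
  cases c
  exacts [le_max_left _ _, le_max_right _ _]

theorem exists_extremalStep_eq (σ d : ℝ) (x : (ℝ × ℝ) × unitInterval) :
    ∃ c, extremalStep σ d x = σ * moranStep d x c := by
  rcases max_choice (σ * moranStep d x false) (σ * moranStep d x true) with hmax | hmax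
  exacts [⟨false, hmax⟩, ⟨true, hmax⟩]

theorem measurable_moranStep (d : ℝ) (c : Bool) : Measurable fun x => moranStep d x c := by
  cases c <;> simp only [moranStep, if_true, Bool.false_eq_true, if_false] <;> fun_prop

theorem measurable_extremalStep (σ d : ℝ) : Measurable (extremalStep σ d) :=
  ((measurable_moranStep d false).const_mul σ).max ((measurable_moranStep d true).const_mul σ)

theorem abs_mul_log_le (hA : 0 < A) {r : ℝ} (hr : r ∈ Icc A (1 - A)) (d : ℝ) :
    |d * Real.log r| ≤ |d| * -Real.log A := by
  have hlog := Real.log_nonpos (hA.le.trans hr.1) (by linarith [hr.2])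
  rw [abs_mul, abs_of_nonpos hlog]
  gcongr
  exact hr.1

theorem exp_mul_extremalStep_le (hA : 0 < A)
    (hx : ∀ c : Bool, (if c then x.1.2 else x.1.1) ∈ Icc A (1 - A)) (hp : (x.2 : ℝ) ∈ Ioo 0 1)
    (hσ : |σ| ≤ 1) (hu : |u| ≤ t) (d : ℝ) :
    Real.exp (u * extremalStep σ d x) ≤
      Real.exp (t * (|d| * -Real.log A)) * ((x.2 : ℝ) ^ (-t) + (1 - (x.2 : ℝ)) ^ (-t)) := by
  obtain ⟨c, hc⟩ := exists_extremalStep_eq σ d x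
  have hq : 0 < 1 - (x.2 : ℝ) := sub_pos.2 hp.2
  set w := if c then 1 - (x.2 : ℝ) else x.2 with hw
  have hw0 : 0 < w := by rw [hw]; split_ifs; exacts [hq, hp.1]
  have hw1 : w ≤ 1 := by rw [hw]; split_ifs; exacts [by linarith [hp.1], hp.2.le]
  have hwt : w ^ (-t) ≤ (x.2 : ℝ) ^ (-t) + (1 - (x.2 : ℝ)) ^ (-t) := by
    have := Real.rpow_nonneg hp.1.le (-t)
    have := Real.rpow_nonneg hq.le (-t)
    rw [hw]; split_ifs <;> linarith
  have hstep : |σ * moranStep d x c| ≤ |d| * -Real.log A + -Real.log w := by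
    rw [abs_mul, moranStep, ← hw]
    refine (mul_le_of_le_one_left (abs_nonneg _) hσ).trans ((abs_sub _ _).trans ?_)
    rw [abs_of_nonpos (Real.log_nonpos hw0.le hw1)]
    exact add_le_add_left (abs_mul_log_le hA (hx c) d) _
  calc Real.exp (u * extremalStep σ d x)
      ≤ Real.exp (t * (|d| * -Real.log A + -Real.log w)) := by
        refine Real.exp_le_exp.2 ((le_abs_self _).trans ?_)
        rw [hc, abs_mul]
        exact mul_le_mul hu hstep (abs_nonneg _) ((abs_nonneg u).trans hu)
    _ = Real.exp (t * (|d| * -Real.log A)) * w ^ (-t) := by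
        rw [Real.rpow_def_of_pos hw0, ← Real.exp_add]
        ring_nf
    _ ≤ _ := by gcongr

theorem abs_extremalStep_neg_one_le (hA : 0 < A)
    (hx : ∀ c : Bool, (if c then x.1.2 else x.1.1) ∈ Icc A (1 - A)) (d : ℝ) :
    |extremalStep (-1) d x| ≤ |d| * -Real.log A + Real.log 2 := by
  have hratio := fun c => abs_le.1 (abs_mul_log_le hA (hx c) d)
  have hweight : ∀ c : Bool, Real.log (if c then 1 - (x.2 : ℝ) else x.2) ≤ 0 := fun c =>
    Real.log_nonpos (by split_ifs; exacts [sub_nonneg.2 x.2.2.2, x.2.2.1])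
      (by split_ifs; exacts [sub_le_self 1 x.2.2.1, x.2.2.2])
  obtain ⟨c, hc⟩ : ∃ c : Bool, 1 / 2 ≤ if c then 1 - (x.2 : ℝ) else x.2 := by
    rcases le_total (1 / 2) (x.2 : ℝ) with hp | hp
    · exact ⟨false, by simpa using hp⟩
    · exact ⟨true, by rw [if_pos rfl]; linarith⟩
  have hlog := Real.log_le_log (by norm_num) hc
  rw [one_div, Real.log_inv] at hlog
  obtain ⟨c', hc'⟩ := exists_extremalStep_eq (-1) d x
  refine abs_le.2 ⟨?_, ?_⟩
  · refine le_trans ?_ (mul_moranStep_le_extremalStep (-1) d x c)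
    rw [moranStep]
    linarith [(hratio c).2]
  · rw [hc', moranStep]
    linarith [(hratio c').1, hweight c', Real.log_pos one_lt_two]

theorem extremalStep_le_add (hA : 0 < A)
    (hx : ∀ c : Bool, (if c then x.1.2 else x.1.1) ∈ Icc A (1 - A)) (hd : 0 ≤ σ * (d - θ)) :
    extremalStep σ d x ≤ extremalStep σ θ x + σ * (d - θ) * Real.log (1 - A) := by
  obtain ⟨c, hc⟩ := exists_extremalStep_eq σ d x
  have hratio := mul_le_mul_of_nonneg_left
    (Real.log_le_log (hA.trans_le (hx c).1) (hx c).2) hd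
  have hθ := mul_moranStep_le_extremalStep σ θ x c
  rw [hc]
  rw [moranStep] at hθ ⊢
  linarith

theorem le_rpow_div_add_iff (ha : 0 < x.1.1) (hb : 0 < x.1.2) (hp : (x.2 : ℝ) ∈ Ioo 0 1) :
    (x.2 : ℝ) ≤ x.1.1 ^ θ / (x.1.1 ^ θ + x.1.2 ^ θ) ↔
      moranStep θ x true ≤ moranStep θ x false := by
  have haθ := Real.rpow_pos_of_pos ha θ
  have hbθ := Real.rpow_pos_of_pos hb θ
  have hq : 0 < 1 - (x.2 : ℝ) := sub_pos.2 hp.2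
  have hodds : (x.2 : ℝ) ≤ x.1.1 ^ θ / (x.1.1 ^ θ + x.1.2 ^ θ) ↔
      (x.2 : ℝ) * x.1.2 ^ θ ≤ (1 - x.2) * x.1.1 ^ θ := by
    rw [le_div_iff₀ (add_pos haθ hbθ)]
    constructor <;> intro <;> linarith
  rw [hodds, ← Real.log_le_log_iff (mul_pos hp.1 hbθ) (mul_pos hq haθ),
    Real.log_mul hp.1.ne' hbθ.ne', Real.log_mul hq.ne' haθ.ne', Real.log_rpow ha,
    Real.log_rpow hb, moranStep, moranStep, if_pos rfl, if_pos rfl, if_neg Bool.false_ne_true,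
    if_neg Bool.false_ne_true]
  constructor <;> intro <;> linarith

theorem extremalStep_one_eq (ha : 0 < x.1.1) (hb : 0 < x.1.2) (hp : (x.2 : ℝ) ∈ Ioo 0 1) :
    extremalStep 1 θ x =
      θ * (if (x.2 : ℝ) ≤ x.1.1 ^ θ / (x.1.1 ^ θ + x.1.2 ^ θ)
        then Real.log x.1.1 else Real.log x.1.2) -
      if (x.2 : ℝ) ≤ x.1.1 ^ θ / (x.1.1 ^ θ + x.1.2 ^ θ)
        then Real.log x.2 else Real.log (1 - (x.2 : ℝ)) := by
  simp only [extremalStep, one_mul, le_rpow_div_add_iff ha hb hp]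
  split_ifs with hmax
  · rw [max_eq_left hmax]
    simp [moranStep]
  · rw [max_eq_right (le_of_not_ge hmax)]
    simp [moranStep]

theorem neg_extremalStep_neg_one_eq (ha : 0 < x.1.1) (hb : 0 < x.1.2)
    (hp : (x.2 : ℝ) ∈ Ioo 0 1) :
    -extremalStep (-1) θ x =
      θ * (if x.1.1 ^ θ / (x.1.1 ^ θ + x.1.2 ^ θ) < (x.2 : ℝ)
        then Real.log x.1.1 else Real.log x.1.2) -
      if x.1.1 ^ θ / (x.1.1 ^ θ + x.1.2 ^ θ) < (x.2 : ℝ)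
        then Real.log x.2 else Real.log (1 - (x.2 : ℝ)) := by
  simp only [extremalStep, neg_one_mul, max_neg_neg, neg_neg, ← not_le,
    le_rpow_div_add_iff ha hb hp, ite_not]
  split_ifs with hmin
  · rw [min_eq_right hmin]
    simp [moranStep]
  · rw [min_eq_left (le_of_not_ge hmin)]
    simp [moranStep]

end ExtremalStep

section RandomModel

variable {Ω : Type*} [MeasurableSpace Ω] {P : Measure Ω}

theorem integrable_rpow_neg_of_lintegral_lt_top {q : Ω → ℝ} (hq : AEMeasurable q P)
    (hq0 : ∀ ω, 0 ≤ q ω) {t : ℝ} (hfin : ∫⁻ ω, ENNReal.ofReal (q ω) ^ (-t) ∂P < ∞) :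
    Integrable (fun ω => q ω ^ (-t)) P := by
  refine (integrable_toReal_of_lintegral_ne_top (hq.ennreal_ofReal.pow_const (-t)) hfin.ne).congr
    (.of_forall fun ω => ?_)
  simp only [← ENNReal.toReal_rpow, ENNReal.toReal_ofReal (hq0 ω)]

theorem ae_pos_of_lintegral_rpow_neg_lt_top {q : Ω → ℝ} (hq : AEMeasurable q P) {t : ℝ}
    (ht : 0 < t) (hfin : ∫⁻ ω, ENNReal.ofReal (q ω) ^ (-t) ∂P < ∞) : ∀ᵐ ω ∂P, 0 < q ω := by
  filter_upwards [ae_lt_top' (hq.ennreal_ofReal.pow_const (-t)) hfin.ne] with ω hω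
  by_contra! hle
  rw [ENNReal.ofReal_of_nonpos hle, ENNReal.zero_rpow_of_neg (neg_neg_of_pos ht)] at hω
  exact lt_irrefl _ hω

theorem integral_mul_sub_eq_zero_of_integral_div_eq {Y Z : Ω → ℝ} {θ : ℝ} (hZ : Integrable Z P)
    (hZ0 : ∫ ω, Z ω ∂P ≠ 0) (hYZ : Integrable (fun ω => θ * Z ω - Y ω) P)
    (hθ : (∫ ω, Y ω ∂P) / ∫ ω, Z ω ∂P = θ) : ∫ ω, (θ * Z ω - Y ω) ∂P = 0 := by
  have hY : Integrable Y P := by simpa [Pi.sub_def] using (hZ.const_mul θ).sub hYZ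
  rw [integral_sub (hZ.const_mul θ) hY, integral_const_mul, sub_eq_zero, eq_comm]
  exact (div_eq_iff hZ0).1 hθ

/-- The ratios and the weight used in step `n` of a random Moran construction. -/
abbrev moranTriple (a b : ℕ → Ω → ℝ) (p : ℕ → Ω → unitInterval) (n : ℕ) (ω : Ω) :
    (ℝ × ℝ) × unitInterval :=
  ((a n ω, b n ω), p n ω)

/-- A random Moran construction with i.i.d. steps, whose ratios are uniformly bounded and whose
weights are nondegenerate. Within one step, the ratios and the weight may depend on each other. -/
structure IsIIDMoranModel (P : Measure Ω) (A B : ℝ) (a b : ℕ → Ω → ℝ)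
    (p : ℕ → Ω → unitInterval) : Prop where
  iIndepFun_triple : iIndepFun (moranTriple a b p) P
  identDistrib_triple : ∀ n, IdentDistrib (moranTriple a b p n) (moranTriple a b p 0) P P
  ae_ratioBounds : ∀ᵐ ω ∂P, MoranRatioBounds A B (fun n => a n ω) fun n => b n ω
  ae_weight_mem : ∀ᵐ ω ∂P, ∀ n, (p n ω : ℝ) ∈ Ioo 0 1

namespace IsIIDMoranModel

variable {A B d θ σ t : ℝ} {a b : ℕ → Ω → ℝ} {p : ℕ → Ω → unitInterval}
  (h : IsIIDMoranModel P A B a b p)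
include h

theorem aemeasurable_triple (n : ℕ) : AEMeasurable (moranTriple a b p n) P :=
  (h.identDistrib_triple n).aemeasurable_fst

theorem aemeasurable_extremalStep (σ d : ℝ) (n : ℕ) :
    AEMeasurable (fun ω => extremalStep σ d (moranTriple a b p n ω)) P :=
  (measurable_extremalStep σ d).comp_aemeasurable (h.aemeasurable_triple n)

theorem identDistrib_extremalStep (σ d : ℝ) (n : ℕ) :
    IdentDistrib (fun ω => extremalStep σ d (moranTriple a b p n ω))
      (fun ω => extremalStep σ d (moranTriple a b p 0 ω)) P P :=
  (h.identDistrib_triple n).comp (measurable_extremalStep σ d)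

theorem iIndepFun_extremalStep (σ d : ℝ) :
    iIndepFun (fun n ω => extremalStep σ d (moranTriple a b p n ω)) P :=
  h.iIndepFun_triple.comp (fun _ => extremalStep σ d) fun _ => measurable_extremalStep σ d

theorem zero_mem_interior_integrableExpSet_extremalStep (hσ : |σ| ≤ 1) (d : ℝ) (ht : 0 < t)
    (hp : ∫⁻ ω, ENNReal.ofReal (p 0 ω : ℝ) ^ (-t) ∂P < ∞)
    (hq : ∫⁻ ω, ENNReal.ofReal (1 - (p 0 ω : ℝ)) ^ (-t) ∂P < ∞) :
    0 ∈ interior (integrableExpSet (fun ω => extremalStep σ d (moranTriple a b p 0 ω)) P) := by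
  have hpm : AEMeasurable (fun ω => (p 0 ω : ℝ)) P :=
    (measurable_subtype_coe.comp measurable_snd).comp_aemeasurable (h.aemeasurable_triple 0)
  have hpint := integrable_rpow_neg_of_lintegral_lt_top hpm (fun ω => (p 0 ω).2.1) hp
  have hqint := integrable_rpow_neg_of_lintegral_lt_top (hpm.const_sub 1)
    (fun ω => sub_nonneg.2 (p 0 ω).2.2) hq
  refine mem_interior_iff_mem_nhds.2 (mem_of_superset (Metric.ball_mem_nhds 0 ht) fun u hu => ?_)
  refine ((hpint.add hqint).const_mul (Real.exp (t * (|d| * -Real.log A)))).mono'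
    ((h.aemeasurable_extremalStep σ d 0).const_mul u).exp.aestronglyMeasurable ?_
  filter_upwards [h.ae_ratioBounds, h.ae_weight_mem] with ω hω hpω
  rw [Real.norm_eq_abs, Real.abs_exp]
  exact exp_mul_extremalStep_le hω.A_pos (hω.ratio_mem 0) (hpω 0) hσ
    (by simpa using (Metric.mem_ball.1 hu).le) d

theorem zero_mem_interior_integrableExpSet_extremalStep_neg_one [IsFiniteMeasure P] (d : ℝ) :
    0 ∈ interior (integrableExpSet (fun ω => extremalStep (-1) d (moranTriple a b p 0 ω)) P) := by
  refine mem_interior_iff_mem_nhds.2 (mem_of_superset univ_mem fun u _ => ?_)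
  refine Integrable.of_bound ((h.aemeasurable_extremalStep (-1) d 0).const_mul
    u).exp.aestronglyMeasurable (Real.exp (|u| * (|d| * -Real.log A + Real.log 2))) ?_
  filter_upwards [h.ae_ratioBounds] with ω hω
  rw [Real.norm_eq_abs, Real.abs_exp, Real.exp_le_exp]
  refine (le_abs_self _).trans ?_
  rw [abs_mul]
  gcongr
  exact abs_extremalStep_neg_one_le hω.A_pos (hω.ratio_mem 0) d

theorem ae_exists_logScalingDefect_isLittleO (hσ : σ * σ = 1)
    (hint : Integrable (fun ω => extremalStep σ θ (moranTriple a b p 0 ω)) P)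
    (hzero : ∫ ω, extremalStep σ θ (moranTriple a b p 0 ω) ∂P = 0) :
    ∀ᵐ ω ∂P, ∃ v, logScalingDefect (fun n => a n ω) (fun n => b n ω) (fun n => p n ω) θ v
      =o[atTop] fun n : ℕ => (n : ℝ) := by
  have hlaw := strong_law_ae_real _ hint
    (fun i j hij => (h.iIndepFun_extremalStep σ θ).indepFun hij) (h.identDistrib_extremalStep σ θ)
  rw [hzero] at hlaw
  filter_upwards [h.ae_ratioBounds, h.ae_weight_mem, hlaw] with ω hω hp hlim
  choose v hv using fun n => exists_extremalStep_eq σ θ (moranTriple a b p n ω)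
  refine ⟨v, (Asymptotics.isLittleO_iff_tendsto' ?_).2 ?_⟩
  · filter_upwards [eventually_ne_atTop 0] with n hn h0
    exact absurd h0 (by exact_mod_cast hn)
  · have hdefect : ∀ n, logScalingDefect (fun n => a n ω) (fun n => b n ω) (fun n => p n ω) θ v n =
        σ * ∑ i ∈ Finset.range n, extremalStep σ θ (moranTriple a b p i ω) := fun n => by
      rw [hω.logScalingDefect_eq_sum hp, Finset.sum_congr rfl fun i _ => hv i, ← Finset.mul_sum,
        ← mul_assoc, hσ, one_mul]
    simpa only [hdefect, mul_div_assoc, mul_zero] using hlim.const_mul σ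

variable [IsProbabilityMeasure P]

theorem integral_extremalStep_neg (hd : 0 < σ * (d - θ))
    (hintd : Integrable (fun ω => extremalStep σ d (moranTriple a b p 0 ω)) P)
    (hintθ : Integrable (fun ω => extremalStep σ θ (moranTriple a b p 0 ω)) P)
    (hzero : ∫ ω, extremalStep σ θ (moranTriple a b p 0 ω) ∂P = 0) :
    ∫ ω, extremalStep σ d (moranTriple a b p 0 ω) ∂P < 0 := by
  obtain ⟨ω, hω⟩ := h.ae_ratioBounds.exists
  have hlog := mul_neg_of_pos_of_neg hd (neg_pos.1 hω.neg_log_one_sub_A_pos)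
  have hle := integral_mono_ae hintd (hintθ.add (integrable_const _)) (h.ae_ratioBounds.mono
    fun ω hω => extremalStep_le_add hω.A_pos (hω.ratio_mem 0) hd.le)
  simp only [Pi.add_apply] at hle
  rw [integral_add hintθ (integrable_const _), hzero] at hle
  simpa using hle.trans_lt (by simpa using hlog)

theorem ae_holdsAcrossLogGaps_logScalingDefect
    (hexp : ∀ d, 0 ∈ interior
      (integrableExpSet (fun ω => extremalStep σ d (moranTriple a b p 0 ω)) P))
    (hzero : ∫ ω, extremalStep σ θ (moranTriple a b p 0 ω) ∂P = 0) (hd : 0 < σ * (d - θ)) :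
    ∀ᵐ ω ∂P, HoldsAcrossLogGaps fun N M => ∀ v,
      σ * logScalingDefect (fun n => a n ω) (fun n => b n ω) (fun n => p n ω) d v M ≤
        σ * logScalingDefect (fun n => a n ω) (fun n => b n ω) (fun n => p n ω) d v N := by
  have hneg := h.integral_extremalStep_neg hd
    (integrable_of_mem_interior_integrableExpSet (hexp d))
    (integrable_of_mem_interior_integrableExpSet (hexp θ)) hzero
  filter_upwards [h.ae_ratioBounds, h.ae_weight_mem, ae_holdsAcrossLogGaps_sum_nonpos
    (h.iIndepFun_extremalStep σ d) (h.identDistrib_extremalStep σ d) (hexp d) hneg]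
    with ω hω hp hsum
  refine hsum.mono fun N k hNk v => ?_
  have hstep := Finset.sum_le_sum fun i (_ : i ∈ Finset.Ico N (N + k)) =>
    mul_moranStep_le_extremalStep σ d (moranTriple a b p i ω) (v i)
  rw [← Finset.mul_sum, Finset.sum_Ico_eq_sub _ (Nat.le_add_right N k),
    ← hω.logScalingDefect_eq_sum hp, ← hω.logScalingDefect_eq_sum hp] at hstep
  linarith

theorem integrable_ite_log {C : (ℝ × ℝ) × unitInterval → Prop} [DecidablePred C]
    (hC : MeasurableSet {x | C x}) : Integrable (fun ω =>
      if C (moranTriple a b p 0 ω) then Real.log (a 0 ω) else Real.log (b 0 ω)) P := by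
  have hmeas : Measurable fun x : (ℝ × ℝ) × unitInterval =>
      if C x then Real.log x.1.1 else Real.log x.1.2 :=
    Measurable.ite hC (by fun_prop) (by fun_prop)
  refine Integrable.of_bound
    (hmeas.comp_aemeasurable (h.aemeasurable_triple 0)).aestronglyMeasurable (-Real.log A) ?_
  filter_upwards [h.ae_ratioBounds] with ω hω
  split_ifs
  · simpa using abs_mul_log_le hω.A_pos (hω.ratio_mem 0 false) 1
  · simpa using abs_mul_log_le hω.A_pos (hω.ratio_mem 0 true) 1

theorem integral_ite_log_neg {C : (ℝ × ℝ) × unitInterval → Prop} [DecidablePred C]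
    (hC : MeasurableSet {x | C x}) :
    ∫ ω, (if C (moranTriple a b p 0 ω) then Real.log (a 0 ω) else Real.log (b 0 ω)) ∂P < 0 := by
  obtain ⟨ω, hω⟩ := h.ae_ratioBounds.exists
  refine (integral_mono_ae (h.integrable_ite_log hC) (integrable_const (Real.log (1 - A)))
    (h.ae_ratioBounds.mono fun ω hω => ?_)).trans_lt
      (by simpa using hω.neg_log_one_sub_A_pos)
  dsimp only
  split_ifs
  exacts [Real.log_le_log (hω.a_pos 0) (hω.ratio_mem 0 false).2,
    Real.log_le_log (hω.b_pos 0) (hω.ratio_mem 0 true).2]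

theorem integral_extremalStep_one_eq_zero
    (hint : Integrable (fun ω => extremalStep 1 θ (moranTriple a b p 0 ω)) P)
    (hθ : moranG P (a 0) (b 0) (p 0) θ = θ) :
    ∫ ω, extremalStep 1 θ (moranTriple a b p 0 ω) ∂P = 0 := by
  have hC : MeasurableSet {x : (ℝ × ℝ) × unitInterval |
      (x.2 : ℝ) ≤ x.1.1 ^ θ / (x.1.1 ^ θ + x.1.2 ^ θ)} :=
    measurableSet_le (by fun_prop) (by fun_prop)
  have hstep := (h.ae_ratioBounds.and h.ae_weight_mem).mono fun ω hω =>
    extremalStep_one_eq (θ := θ) (x := moranTriple a b p 0 ω) (hω.1.a_pos 0) (hω.1.b_pos 0) (hω.2 0)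
  rw [integral_congr_ae hstep]
  exact integral_mul_sub_eq_zero_of_integral_div_eq (h.integrable_ite_log hC)
    (h.integral_ite_log_neg hC).ne (hint.congr hstep) hθ

theorem integral_extremalStep_neg_one_eq_zero (hθ : moranG' P (a 0) (b 0) (p 0) θ = θ) :
    ∫ ω, extremalStep (-1) θ (moranTriple a b p 0 ω) ∂P = 0 := by
  have hC : MeasurableSet {x : (ℝ × ℝ) × unitInterval |
      x.1.1 ^ θ / (x.1.1 ^ θ + x.1.2 ^ θ) < (x.2 : ℝ)} :=
    measurableSet_lt (by fun_prop) (by fun_prop)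
  have hint := (integrable_of_mem_interior_integrableExpSet
    (h.zero_mem_interior_integrableExpSet_extremalStep_neg_one θ)).neg
  have hstep := (h.ae_ratioBounds.and h.ae_weight_mem).mono fun ω hω =>
    neg_extremalStep_neg_one_eq (θ := θ) (x := moranTriple a b p 0 ω) (hω.1.a_pos 0)
      (hω.1.b_pos 0) (hω.2 0)
  rw [← neg_eq_zero, ← integral_neg, integral_congr_ae hstep]
  exact integral_mul_sub_eq_zero_of_integral_div_eq (h.integrable_ite_log hC)
    (h.integral_ite_log_neg hC).ne (hint.congr hstep) hθ

end IsIIDMoranModel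

theorem IsRandomMoranModel.isIIDMoranModel {A B : ℝ} {a b : ℕ → Ω → ℝ}
    {p : ℕ → Ω → unitInterval} (h : IsRandomMoranModel P A B a b p) :
    IsIIDMoranModel P A B a b p := by
  have := h.iIndepFun_p.isProbabilityMeasure
  have mab (n) : Measurable fun ω => (a n ω, b n ω) := (h.measurable_a n).prodMk (h.measurable_b n)
  have hind (n) : IndepFun (fun ω => (a n ω, b n ω)) (p n) P :=
    h.indepFun_ab_p.comp (measurable_pi_apply n) (measurable_pi_apply n)
  have hpm : Measurable fun ω => (p 0 ω : ℝ) := measurable_subtype_coe.comp (h.measurable_p 0)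
  obtain ⟨t, ht, hp, hq⟩ := h.moment_p
  have hp0 : ∀ᵐ ω ∂P, (p 0 ω : ℝ) ∈ Ioo 0 1 := by
    filter_upwards [ae_pos_of_lintegral_rpow_neg_lt_top hpm.aemeasurable ht hp,
      ae_pos_of_lintegral_rpow_neg_lt_top (hpm.const_sub 1).aemeasurable ht hq] with ω hp hq
    exact ⟨hp, sub_pos.1 hq⟩
  exact {
    iIndepFun_triple := iIndepFun_prodMk (fun n => (mab n).aemeasurable)
      (fun n => (h.measurable_p n).aemeasurable) h.iIndepFun_ab h.iIndepFun_p h.indepFun_ab_p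
    identDistrib_triple := fun n =>
      (h.identDistrib_ab n).prodMk (h.identDistrib_p n) (hind n) (hind 0)
    ae_ratioBounds := .of_forall fun ω => ⟨h.A_pos, h.B_lt_one,
      fun n => (le_min_iff.1 (h.A_le_min n ω)).1, fun n => (le_min_iff.1 (h.A_le_min n ω)).2,
      fun n => h.add_le_B n ω⟩
    ae_weight_mem := ae_all_iff.2 fun n => (h.identDistrib_p n).symm.ae_snd
      (measurable_subtype_coe measurableSet_Ioo) hp0 }

theorem mainTheorem6_general [IsProbabilityMeasure P] {A B : ℝ} {a b : ℕ → Ω → ℝ}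
    {p : ℕ → Ω → unitInterval} (h : IsIIDMoranModel P A B a b p) :
    (∀ t : ℝ, 0 < t → ∫⁻ ω, ENNReal.ofReal (p 0 ω : ℝ) ^ (-t) ∂P < ∞ →
      ∫⁻ ω, ENNReal.ofReal (1 - (p 0 ω : ℝ)) ^ (-t) ∂P < ∞ →
      ∀ θ : ℝ, moranG P (a 0) (b 0) (p 0) θ = θ →
      ∀ᵐ ω ∂P,
        sSup (upperLocalDim (randomMoranMeasure a b p ω) ''
          (randomMoranMeasure a b p ω).support) = (θ : EReal) ∧
        ∀ Φ : ℝ → ℝ, IsLargeDimensionFunction Φ →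
          upperPhiDim Φ (randomMoranMeasure a b p ω) = (θ : EReal)) ∧
    (∀ θ' : ℝ, moranG' P (a 0) (b 0) (p 0) θ' = θ' →
      ∀ᵐ ω ∂P,
        sInf (lowerLocalDim (randomMoranMeasure a b p ω) ''
          (randomMoranMeasure a b p ω).support) = (θ' : EReal) ∧
        ∀ Φ : ℝ → ℝ, IsLargeDimensionFunction Φ →
          lowerPhiDim Φ (randomMoranMeasure a b p ω) = (θ' : EReal)) := by
  refine ⟨fun t ht hp hq θ hθ => ?_, fun θ hθ => ?_⟩
  · have hexp d :=
      h.zero_mem_interior_integrableExpSet_extremalStep (abs_one (α := ℝ)).le d ht hp hq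
    have hint := integrable_of_mem_interior_integrableExpSet (hexp θ)
    have hzero := h.integral_extremalStep_one_eq_zero hint hθ
    obtain ⟨u, -, hu, hlim⟩ := exists_seq_strictAnti_tendsto θ
    filter_upwards [h.ae_ratioBounds, h.ae_weight_mem,
      ae_all_iff.2 fun k => h.ae_holdsAcrossLogGaps_logScalingDefect (d := u k) hexp hzero
        (by linarith [hu k]),
      h.ae_exists_logScalingDefect_isLittleO (one_mul 1) hint hzero] with ω hω hp hgap ⟨v, hv⟩
    exact hω.sSup_upperLocalDim_eq_and_upperPhiDim_eq hp hlim
      (by simpa only [one_mul] using hgap) hv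
  · have hexp := h.zero_mem_interior_integrableExpSet_extremalStep_neg_one
    have hint := integrable_of_mem_interior_integrableExpSet (hexp θ)
    have hzero := h.integral_extremalStep_neg_one_eq_zero hθ
    obtain ⟨u, -, hu, hlim⟩ := exists_seq_strictMono_tendsto θ
    filter_upwards [h.ae_ratioBounds, h.ae_weight_mem,
      ae_all_iff.2 fun k => h.ae_holdsAcrossLogGaps_logScalingDefect (d := u k) hexp hzero
        (by linarith [hu k]),
      h.ae_exists_logScalingDefect_isLittleO (by norm_num) hint hzero] with ω hω hp hgap ⟨v, hv⟩
    exact hω.sInf_lowerLocalDim_eq_and_lowerPhiDim_eq hp hlim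
      (by simpa only [neg_one_mul, neg_le_neg_iff] using hgap) hv

end RandomModel

theorem mainTheorem6 {Ω : Type*} [MeasurableSpace Ω] (P : Measure Ω) [IsProbabilityMeasure P]
    (A B : ℝ) (a b : ℕ → Ω → ℝ) (p : ℕ → Ω → unitInterval)
    (hmodel : IsRandomMoranModel P A B a b p) :
    (∀ θ : ℝ, 0 ≤ θ → moranG P (a 0) (b 0) (p 0) θ = θ →
      (∀ ψ : ℝ, θ < ψ → moranG P (a 0) (b 0) (p 0) ψ < ψ) →
      ∀ᵐ ω ∂P,
        sSup (upperLocalDim (randomMoranMeasure a b p ω) ''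
          (randomMoranMeasure a b p ω).support) = (θ : EReal) ∧
        ∀ Φ : ℝ → ℝ, IsLargeDimensionFunction Φ →
          upperPhiDim Φ (randomMoranMeasure a b p ω) = (θ : EReal)) ∧
    (∀ θ' : ℝ, 0 ≤ θ' → moranG' P (a 0) (b 0) (p 0) θ' = θ' →
      (∀ ψ : ℝ, 0 ≤ ψ → ψ < θ' → ψ < moranG' P (a 0) (b 0) (p 0) ψ) →
      ∀ᵐ ω ∂P,
        sInf (lowerLocalDim (randomMoranMeasure a b p ω) ''
          (randomMoranMeasure a b p ω).support) = (θ' : EReal) ∧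
        ∀ Φ : ℝ → ℝ, IsLargeDimensionFunction Φ →
          lowerPhiDim Φ (randomMoranMeasure a b p ω) = (θ' : EReal)) := by
  obtain ⟨t, ht, hp, hq⟩ := hmodel.moment_p
  have hmain := mainTheorem6_general hmodel.isIIDMoranModel
  exact ⟨fun θ _ hθ _ => hmain.1 t ht hp hq θ hθ, fun θ' _ hθ' _ => hmain.2 θ' hθ'⟩
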